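/- Let $n\ge 1$ and $\mu,\mu_c,\kappa>0$, and put $\omega=\mu_c/\mu$. For $M\in\mathfrak{gl}(n)=\mathbb{R}^{n\times n}$ write $\operatorname{sym}M=\tfrac12(M+M^T)$, $\operatorname{skew}M=\tfrac12(M-M^T)$, $\operatorname{dev}M=M-\tfrac{\operatorname{tr}M}{n}\mathbb{1}$, $\langle M,N\rangle=\operatorname{tr}(M^TN)$, and $$\langle M,N\rangle_{\mu,\mu_c,\kappa}=\mu\,\langle\operatorname{dev}\operatorname{sym}M,\operatorname{dev}\operatorname{sym}N\rangle+\mu_c\,\langle\operatorname{skew}M,\operatorname{skew}N\rangle+\frac{\kappa}{n}\operatorname{tr}(M)\operatorname{tr}(N),\qquad \|M\|_{\mu,\mu_c,\kappa}=\sqrt{\langle M,M\rangle_{\mu,\mu_c,\kappa}}.$$ Equip $\mathrm{GL}(n)=\{X\in\mathbb{R}^{n\times n}:\det X\ne0\}$ with the (left-$\mathrm{GL}(n)$-invariant and right-$\mathrm{O}(n)$-invariant) Riemannian metric $g_A(M,N)=\langle A^{-1}M,A^{-1}N\rangle_{\mu,\mu_c,\kappa}$. For $A,B\in\mathrm{GL}(n)$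 let $\mathcal{A}_A^B$ be the set of continuous curves $Y\colon[a,b]\to\mathrm{GL}(n)$, $a<b$ arbitrary reals, with $Y(a)=A$, $Y(b)=B$, for which there are $a=a_0<a_1<\dots<a_{m+1}=b$ such that each restriction $Y|_{[a_j,a_{j+1}]}$ is continuously differentiable with nowhere vanishing derivative (one-sided at the endpoints). The length of a piecewise continuously differentiable curve is $L(Y)=\int_a^b\sqrt{g_{Y(t)}(\dot Y(t),\dot Y(t))}\,dt$, and $\operatorname{dist}_{\mathrm{geod}}(A,B)=\inf_{Y\in\mathcal{A}_A^B}L(Y)\in[0,\infty]$. Theorem. Let $A,B\in\mathrm{GL}^+(n)=\{X:\det X>0\}$. Then there exists $M\in\mathfrak{gl}(n)$ such that the curve $$X\colon[0,1]\to\mathrm{GL}^+(n),\qquad X(t)=A\,\exp\bigl(t(\operatorname{sym}M-\omega\operatorname{skew}M)\bigr)\,\exp\bigl(t(1+\omega)\operatorname{skew}M\bigr)$$ is a shortest curve connecting $A$ and $B$, i.e. $X(0)=A$, $X(1)=B$, $X\in\mathcal{A}_A^B$ if $A\neq B$ (for $A=B$ the curve $X$ is constant), and $$\|M\|_{\mu,\mu_c,\kappa}=L(X)=\operatorname{dist}_{\mathrm{geod}}(A,B)=\inf_{Y\in\mathcal{A}_A^B}L(Y).$$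 -/

import Mathlib

/-! Real `n × n` matrices carry the Frobenius norm `‖M‖ = sqrt (∑ M i j ^ 2)`. -/
attribute [local instance] Matrix.frobeniusNormedAddCommGroup
attribute [local instance] Matrix.frobeniusNormedSpace

noncomputable section

namespace GLGeodesic

/-- The space of real `n × n` matrices, `𝔤𝔩(n)`. -/
abbrev Mat (n : ℕ) : Type := Matrix (Fin n) (Fin n) ℝ

/-- `GL(n) = {X | det X ≠ 0}`. -/
def GLSet (n : ℕ) : Set (Mat n) := {X | X.det ≠ 0}

/-- `GL⁺(n) = {X | det X > 0}`. -/
def GLPosSet (n : ℕ) : Set (Mat n) := {X | 0 < X.det}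

variable {n : ℕ}

/-- The symmetric part `(M + Mᵀ) / 2`. -/
def sym (M : Mat n) : Mat n := (1 / 2 : ℝ) • (M + M.transpose)

/-- The skew symmetric part `(M - Mᵀ) / 2`. -/
def skew (M : Mat n) : Mat n := (1 / 2 : ℝ) • (M - M.transpose)

/-- The deviator `M - (tr M / n) • 1`. -/
def dev (M : Mat n) : Mat n := M - (M.trace / (n : ℝ)) • (1 : Mat n)

/-- The canonical inner product `⟨M, N⟩ = tr (Mᵀ N)`. -/
def canonInner (M N : Mat n) : ℝ := (M.transpose * N).trace

/-- The isotropic inner product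
`μ ⟨dev sym M, dev sym N⟩ + μc ⟨skew M, skew N⟩ + (κ / n) (tr M) (tr N)`. -/
def isoInner (μ μc κ : ℝ) (M N : Mat n) : ℝ :=
  μ * canonInner (dev (sym M)) (dev (sym N)) + μc * canonInner (skew M) (skew N)
    + κ / (n : ℝ) * M.trace * N.trace

/-- The norm induced by the isotropic inner product. -/
def isoNorm (μ μc κ : ℝ) (M : Mat n) : ℝ := Real.sqrt (isoInner μ μc κ M M)

/-- The Riemannian metric `g_A(M, N) = ⟨A⁻¹ M, A⁻¹ N⟩_{μ,μc,κ}` on `GL(n)`. -/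
def metric (μ μc κ : ℝ) (A M N : Mat n) : ℝ := isoInner μ μc κ (A⁻¹ * M) (A⁻¹ * N)

/-- The length of a curve on `[a, b]`. Curves on `[a, b]` are represented by functions on `ℝ`, of
which only the values on `[a, b]` matter: `deriv X t` for `a < t < b` is determined by them. For an
admissible curve it exists at all but finitely many `t`, and the integrand is integrable. -/
def curveLength (μ μc κ : ℝ) (X : ℝ → Mat n) (a b : ℝ) : ℝ :=
  ∫ t in a..b, Real.sqrt (metric μ μc κ (X t) (deriv X t) (deriv X t))

/-- Regular `C¹` curves on the closed interval `[a, b]`, with one-sided derivatives at the ends. -/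
def IsRegularC1 (X : ℝ → Mat n) (a b : ℝ) : Prop :=
  ContDiffOn ℝ 1 X (Set.Icc a b) ∧ ∀ t ∈ Set.Icc a b, derivWithin X (Set.Icc a b) t ≠ 0

/-- `X` is, on `[a, b]`, a continuous curve in `GL(n)` from `A` to `B` which is piecewise `C¹` and
regular with respect to some partition `a = p₀ < p₁ < ⋯ < p_{m+1} = b`. -/
structure IsAdmissible (A B : Mat n) (a b : ℝ) (X : ℝ → Mat n) : Prop where
  mem_GL : ∀ t ∈ Set.Icc a b, X t ∈ GLSet n
  continuousOn : ContinuousOn X (Set.Icc a b)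
  piecewise : ∃ (m : ℕ) (p : Fin (m + 2) → ℝ), StrictMono p ∧ p 0 = a ∧ p (Fin.last (m + 1)) = b ∧
    ∀ j : Fin (m + 1), IsRegularC1 X (p j.castSucc) (p j.succ)
  left_eq : X a = A
  right_eq : X b = B

/-- The geodesic distance: the infimum, in `[0, ∞]`, of the lengths of all admissible curves from
`A` to `B`, over arbitrary parameter intervals. -/
def geodDist (μ μc κ : ℝ) (A B : Mat n) : ENNReal :=
  ⨅ (a : ℝ) (b : ℝ) (X : ℝ → Mat n) (_ : IsAdmissible A B a b X),
    ENNReal.ofReal (curveLength μ μc κ X a b)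

/-- The curve `t ↦ A exp(t (sym M - ω skew M)) exp(t (1 + ω) skew M)`. -/
def geodCurve (ω : ℝ) (A M : Mat n) (t : ℝ) : Mat n :=
  A * NormedSpace.exp (t • (sym M - ω • skew M)) * NormedSpace.exp ((t * (1 + ω)) • skew M)

end GLGeodesic

end

noncomputable section

namespace GLGeodesic

section Geodesics

attribute [local instance] Matrix.frobeniusNormedRing
attribute [local instance] Matrix.frobeniusNormedAlgebra

open Matrix Set Filter Topology

/-! ### Algebra of the isotropic inner product -/

section Algebra

variable {n : ℕ}

/-! Write E for `geodMap`, so that the candidate curves are A E(tM). Their left-trivialised velocity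
is M conjugated by a rotation, hence they have constant speed ‖M‖. Everything rests on the matrix
`momentum`, which represents ⟨N, ·⟩ through the trace form and, because ω = μc/μ, commutes with sym
N - ω skew N. The trace against a commuting matrix does not see the noncommutativity in the
derivative of exp (`trace_mul_fderiv_exp`); this yields the Gauss lemma (`isoInner_turn_of_fderiv`),
and commutation alone yields conservation of momentum (`isoInner_turn_of_conj`).

Near 0 the map E is a local diffeomorphism, and the Gauss lemma with Cauchy–Schwarz shows that a
short curve is no shorter than some geodesic with the same ends (`exists_geodMap_of_short`).
Arbitrary curves are handled through broken geodesics, encoded as lists of velocities. With the end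
point and the number of pieces fixed, one of least energy exists by compactness; if its pieces are
short, the first variation excludes corners (`eq_turn_of_minimal`), so it is a single geodesic
(`endPoint_of_minimal`). Cutting a curve of length L into k parts of equal length gives a broken
geodesic of energy at most L²/k. For large k this is small enough to straighten, and the result has
norm at most L (`IsAdmissible.exists_geodMap`).

That some geodesic joins A to B is seen in the same way: products of values of E exhaust the
matrices of positive determinant, by Gaussian elimination (`mem_reachable_of_det_pos`), and any such
product can be straightened after subdividing its factors (`exists_geodMap_eq_of_list`). Compactness
then selects a shortest geodesic. If A = B, the constant curve is not admissible, but arbitrarily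
short loops show that the infimum is 0. -/

theorem sym_add_skew (M : Mat n) : sym M + skew M = M := by
  rw [sym, skew, ← smul_add, add_add_sub_cancel, ← two_smul ℝ, smul_smul]
  norm_num

theorem transpose_sym (M : Mat n) : (sym M)ᵀ = sym M := by
  simp [sym, add_comm]

theorem transpose_skew (M : Mat n) : (skew M)ᵀ = -skew M := by
  simp [skew, ← smul_neg]

theorem sym_smul (c : ℝ) (M : Mat n) : sym (c • M) = c • sym M := by
  simp [sym, smul_comm c]

theorem skew_smul (c : ℝ) (M : Mat n) : skew (c • M) = c • skew M := by
  simp [skew, smul_comm c, ← smul_sub]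

theorem sym_conj (Q M : Mat n) : sym (Qᵀ * M * Q) = Qᵀ * sym M * Q := by
  simp [sym, Matrix.mul_add, Matrix.add_mul, Matrix.mul_assoc]

theorem skew_conj (Q M : Mat n) : skew (Qᵀ * M * Q) = Qᵀ * skew M * Q := by
  simp [skew, Matrix.mul_sub, Matrix.sub_mul, Matrix.mul_assoc]

/-- The matrix representing `isoInner μ μc κ M` through the trace form. -/
def momentum (μ μc κ : ℝ) (M : Mat n) : Mat n :=
  μ • sym M - μc • skew M + ((κ - μ) / n * M.trace) • 1

theorem isoInner_eq_trace (hn : 1 ≤ n) (μ μc κ : ℝ) (M N : Mat n) :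
    isoInner μ μc κ M N = (momentum μ μc κ M * N).trace := by
  have hn' : (n : ℝ) ≠ 0 := by positivity
  -- After expansion, only tr(MN), tr(MᵀN) and tr M · tr N remain.
  have h1 : (Mᵀ * Nᵀ).trace = (M * N).trace := by
    rw [← transpose_mul, trace_transpose, trace_mul_comm]
  have h2 : (M * Nᵀ).trace = (Mᵀ * N).trace := by
    rw [← trace_transpose, transpose_mul, transpose_transpose, trace_mul_comm]
  simp only [isoInner, momentum, canonInner, dev, sym, skew, transpose_sub, transpose_smul,
    transpose_add, transpose_transpose, transpose_one, Matrix.mul_sub, Matrix.sub_mul,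
    Matrix.add_mul, Matrix.mul_add, Matrix.smul_mul, Matrix.mul_smul, trace_sub, trace_add,
    trace_smul, trace_one, Matrix.mul_one, Matrix.one_mul, trace_transpose, smul_eq_mul, h1, h2,
    Fintype.card_fin]
  field_simp
  ring

theorem isoInner_comm (μ μc κ : ℝ) (M N : Mat n) :
    isoInner μ μc κ M N = isoInner μ μc κ N M := by
  have h : ∀ X Y : Mat n, canonInner X Y = canonInner Y X := fun X Y => by
    rw [canonInner, ← trace_transpose, transpose_mul, transpose_transpose, canonInner]
  rw [isoInner, isoInner, h (dev _), h (skew _)]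
  ring

theorem canonInner_self (M : Mat n) : canonInner M M = ‖M‖ ^ 2 := by
  rw [Matrix.frobenius_norm_def, ← Real.sqrt_eq_rpow, Real.sq_sqrt (by positivity), canonInner,
    trace, Finset.sum_comm]
  refine Finset.sum_congr rfl fun i _ => ?_
  simp [Matrix.mul_apply, sq]

theorem isoInner_self (μ μc κ : ℝ) (M : Mat n) :
    isoInner μ μc κ M M =
      μ * ‖dev (sym M)‖ ^ 2 + μc * ‖skew M‖ ^ 2 + κ / n * M.trace ^ 2 := by
  rw [isoInner, canonInner_self, canonInner_self]
  ring

/-- With all three parameters equal to 1 the momentum of `M` is `Mᵀ`. The Frobenius norm thus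
belongs to the same family and can be compared coefficient by coefficient. -/
theorem norm_sq_eq_isoInner (hn : 1 ≤ n) (M : Mat n) : ‖M‖ ^ 2 = isoInner 1 1 1 M M := by
  rw [isoInner_eq_trace hn, ← canonInner_self, canonInner, momentum]
  simp only [sub_self, zero_div, zero_mul, zero_smul, add_zero, one_smul]
  congr 2
  rw [← transpose_sym, ← neg_eq_iff_eq_neg.2 (transpose_skew M), sub_neg_eq_add, ← transpose_add,
    sym_add_skew]

theorem isoInner_self_nonneg {μ μc κ : ℝ} (hμ : 0 < μ) (hμc : 0 < μc) (hκ : 0 < κ) (M : Mat n) :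
    0 ≤ isoInner μ μc κ M M := by
  rw [isoInner_self]
  positivity

theorem isoNorm_sq {μ μc κ : ℝ} (hμ : 0 < μ) (hμc : 0 < μc) (hκ : 0 < κ) (M : Mat n) :
    isoNorm μ μc κ M ^ 2 = isoInner μ μc κ M M :=
  Real.sq_sqrt (isoInner_self_nonneg hμ hμc hκ M)

theorem isoNorm_nonneg (μ μc κ : ℝ) (M : Mat n) : 0 ≤ isoNorm μ μc κ M :=
  Real.sqrt_nonneg _

/-- The isotropic norm dominates the Frobenius norm. -/
theorem exists_norm_le_isoNorm (hn : 1 ≤ n) {μ μc κ : ℝ} (hμ : 0 < μ) (hμc : 0 < μc)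
    (hκ : 0 < κ) : ∃ c : ℝ, 0 < c ∧ ∀ M : Mat n, ‖M‖ ≤ c * isoNorm μ μc κ M := by
  set m := min μ (min μc κ) with hm
  have hm0 : 0 < m := by simp [hm, hμ, hμc, hκ]
  refine ⟨(Real.sqrt m)⁻¹, by positivity, fun M => ?_⟩
  rw [inv_mul_eq_div, le_div_iff₀ (Real.sqrt_pos.2 hm0), mul_comm]
  refine Real.le_sqrt_of_sq_le ?_
  rw [mul_pow, Real.sq_sqrt hm0.le, norm_sq_eq_isoInner hn, isoInner_self, isoInner_self]
  have h1 : m ≤ μ := min_le_left _ _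
  have h2 : m ≤ μc := (min_le_right _ _).trans (min_le_left _ _)
  have h3 : m ≤ κ := (min_le_right _ _).trans (min_le_right _ _)
  have e1 := mul_le_mul_of_nonneg_right h1 (sq_nonneg ‖dev (sym M)‖)
  have e2 := mul_le_mul_of_nonneg_right h2 (sq_nonneg ‖skew M‖)
  have e3 := mul_le_mul_of_nonneg_right h3 (div_nonneg (sq_nonneg M.trace) n.cast_nonneg)
  calc _ = m * ‖dev (sym M)‖ ^ 2 + m * ‖skew M‖ ^ 2 + m * (M.trace ^ 2 / n) := by ring
    _ ≤ μ * ‖dev (sym M)‖ ^ 2 + μc * ‖skew M‖ ^ 2 + κ * (M.trace ^ 2 / n) := by gcongr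
    _ = _ := by ring

theorem eq_zero_of_isoInner_self (hn : 1 ≤ n) {μ μc κ : ℝ} (hμ : 0 < μ) (hμc : 0 < μc)
    (hκ : 0 < κ) {M : Mat n} (h : isoInner μ μc κ M M = 0) : M = 0 := by
  obtain ⟨c, -, hc⟩ := exists_norm_le_isoNorm hn hμ hμc hκ
  have := hc M
  rw [isoNorm, h, Real.sqrt_zero, mul_zero] at this
  exact norm_le_zero_iff.1 this

/-- The isotropic inner product as a bilinear map. -/
theorem isBilinearMap_isoInner (hn : 1 ≤ n) (μ μc κ : ℝ) :
    IsBilinearMap ℝ (fun M N : Mat n => isoInner μ μc κ M N) where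
  add_left M M' N := by
    rw [isoInner_comm, isoInner_comm _ _ _ M, isoInner_comm _ _ _ M']
    simp [isoInner_eq_trace hn, Matrix.mul_add]
  smul_left c M N := by
    rw [isoInner_comm, isoInner_comm _ _ _ M]
    simp [isoInner_eq_trace hn]
  add_right M N N' := by simp [isoInner_eq_trace hn, Matrix.mul_add]
  smul_right c M N := by simp [isoInner_eq_trace hn]

theorem isoNorm_zero (μ μc κ : ℝ) : isoNorm μ μc κ (0 : Mat n) = 0 := by
  simp [isoNorm, isoInner, sym, skew, dev, canonInner]

theorem isoNorm_smul (hn : 1 ≤ n) (μ μc κ : ℝ) {c : ℝ} (hc : 0 ≤ c) (M : Mat n) :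
    isoNorm μ μc κ (c • M) = c * isoNorm μ μc κ M := by
  have h := isBilinearMap_isoInner hn μ μc κ
  have : isoInner μ μc κ (c • M) (c • M) = c ^ 2 * isoInner μ μc κ M M := by
    rw [h.smul_left, h.smul_right, smul_eq_mul, smul_eq_mul]
    ring
  rw [isoNorm, this, Real.sqrt_mul (sq_nonneg c), Real.sqrt_sq hc, isoNorm]

/-- Cauchy–Schwarz, from the discriminant of the nonnegative quadratic t ↦ ‖M + tN‖². -/
theorem isoInner_le_isoNorm_mul (hn : 1 ≤ n) {μ μc κ : ℝ} (hμ : 0 < μ) (hμc : 0 < μc)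
    (hκ : 0 < κ) (M N : Mat n) :
    isoInner μ μc κ M N ≤ isoNorm μ μc κ M * isoNorm μ μc κ N := by
  have h := isBilinearMap_isoInner hn μ μc κ
  have key : ∀ t : ℝ, 0 ≤ isoInner μ μc κ N N * (t * t) + (2 * isoInner μ μc κ M N) * t
      + isoInner μ μc κ M M := fun t => by
    have h0 := isoInner_self_nonneg hμ hμc hκ (M + t • N)
    rw [h.add_left, h.add_right, h.add_right, h.smul_left, h.smul_left, h.smul_right,
      h.smul_right, isoInner_comm _ _ _ N M] at h0
    simp only [smul_eq_mul] at h0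
    linarith
  have hd := discrim_le_zero key
  refine (abs_le_of_sq_le_sq' ?_
    (mul_nonneg (isoNorm_nonneg _ _ _ _) (isoNorm_nonneg _ _ _ _))).2
  rw [mul_pow, isoNorm_sq hμ hμc hκ, isoNorm_sq hμ hμc hκ]
  rw [discrim] at hd
  linarith

/-- Orthogonal conjugation respects `sym`, `skew` and the trace; this is the source of the right
O(n)-invariance of the metric. -/
theorem momentum_conj {μ μc κ : ℝ} {Q : Mat n} (hQ : Qᵀ * Q = 1) (M : Mat n) :
    momentum μ μc κ (Qᵀ * M * Q) = Qᵀ * momentum μ μc κ M * Q := by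
  have hQ' : Q * Qᵀ = 1 := mul_eq_one_comm.1 hQ
  have ht : (Qᵀ * M * Q).trace = M.trace := by
    rw [trace_mul_comm, ← Matrix.mul_assoc, hQ', Matrix.one_mul]
  simp only [momentum, sym_conj, skew_conj, ht, Matrix.mul_add, Matrix.add_mul, Matrix.mul_sub,
    Matrix.sub_mul, Matrix.mul_smul, Matrix.smul_mul, Matrix.mul_one, hQ]

theorem isoInner_conj (hn : 1 ≤ n) {μ μc κ : ℝ} {Q : Mat n} (hQ : Qᵀ * Q = 1) (M N : Mat n) :
    isoInner μ μc κ (Qᵀ * M * Q) N = isoInner μ μc κ M (Q * N * Qᵀ) := by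
  rw [isoInner_eq_trace hn, isoInner_eq_trace hn, momentum_conj hQ, Matrix.mul_assoc,
    Matrix.mul_assoc, trace_mul_comm]
  simp only [Matrix.mul_assoc]

theorem isoInner_conj_self (hn : 1 ≤ n) {μ μc κ : ℝ} {Q : Mat n} (hQ : Qᵀ * Q = 1) (M : Mat n) :
    isoInner μ μc κ (Qᵀ * M * Q) (Qᵀ * M * Q) = isoInner μ μc κ M M := by
  have hQ' : Q * Qᵀ = 1 := mul_eq_one_comm.1 hQ
  rw [isoInner_conj hn hQ]
  congr 1
  calc Q * (Qᵀ * M * Q) * Qᵀ = (Q * Qᵀ) * M * (Q * Qᵀ) := by simp only [Matrix.mul_assoc]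
    _ = M := by rw [hQ', Matrix.one_mul, Matrix.mul_one]

theorem isoNorm_conj (hn : 1 ≤ n) {μ μc κ : ℝ} {Q : Mat n} (hQ : Qᵀ * Q = 1) (M : Mat n) :
    isoNorm μ μc κ (Qᵀ * M * Q) = isoNorm μ μc κ M := by
  rw [isoNorm, isoInner_conj_self hn hQ, isoNorm]

theorem continuous_isoInner_self (hn : 1 ≤ n) (μ μc κ : ℝ) :
    Continuous fun M : Mat n => isoInner μ μc κ M M := by
  simp only [isoInner_eq_trace hn, momentum, sym, skew]
  fun_prop

theorem continuous_isoNorm (hn : 1 ≤ n) (μ μc κ : ℝ) :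
    Continuous fun M : Mat n => isoNorm μ μc κ M :=
  (continuous_isoInner_self hn μ μc κ).sqrt

theorem hasDerivAt_isoInner_self (hn : 1 ≤ n) (μ μc κ : ℝ) {N : ℝ → Mat n} {N' : Mat n} {t : ℝ}
    (h : HasDerivAt N N' t) :
    HasDerivAt (fun s => isoInner μ μc κ (N s) (N s)) (2 * isoInner μ μc κ (N t) N') t := by
  have hb := isBilinearMap_isoInner hn μ μc κ
  have h1 := hb.toContinuousBilinearMap.hasFDerivAt_of_bilinear h.hasFDerivAt h.hasFDerivAt
  have h2 := h1.hasDerivAt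
  refine h2.congr_deriv ?_
  change isoInner μ μc κ (N t) ((1 : ℝ) • N') + isoInner μ μc κ ((1 : ℝ) • N') (N t) = _
  rw [one_smul, isoInner_comm _ _ _ N' (N t), two_mul]

end Algebra

/-! ### The geodesic exponential map at the identity -/

section GeodMap

variable {n : ℕ}

theorem contDiff_exp : ContDiff ℝ 1 (NormedSpace.exp : Mat n → Mat n) :=
  contDiff_iff_contDiffAt.2 fun x => (NormedSpace.exp_analytic (𝕂 := ℝ) x).contDiffAt

theorem exp_mul_exp_neg (X : Mat n) : NormedSpace.exp X * NormedSpace.exp (-X) = 1 := by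
  rw [← Matrix.exp_add_of_commute _ _ (Commute.neg_right (Commute.refl X)), add_neg_cancel,
    NormedSpace.exp_zero]

theorem exp_neg_mul_exp (X : Mat n) : NormedSpace.exp (-X) * NormedSpace.exp X = 1 :=
  mul_eq_one_comm.1 (exp_mul_exp_neg X)

/-- exp X is the square of the invertible matrix exp(X/2). -/
theorem det_exp_pos (X : Mat n) : 0 < (NormedSpace.exp X).det := by
  have h : NormedSpace.exp X
      = NormedSpace.exp ((1 / 2 : ℝ) • X) * NormedSpace.exp ((1 / 2 : ℝ) • X) := by
    rw [← Matrix.exp_add_of_commute _ _ (Commute.refl _), ← add_smul]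
    norm_num
  have hne : (NormedSpace.exp ((1 / 2 : ℝ) • X)).det ≠ 0 :=
    det_ne_zero_of_right_inverse (exp_mul_exp_neg _)
  rw [h, det_mul]
  exact mul_self_pos.2 hne

theorem transpose_exp_mul_exp {X : Mat n} (hX : Xᵀ = -X) :
    (NormedSpace.exp X)ᵀ * NormedSpace.exp X = 1 := by
  rw [← Matrix.exp_transpose, hX, exp_neg_mul_exp]

theorem commute_exp {X Y : Mat n} (h : Commute X Y) : Commute X (NormedSpace.exp Y) :=
  h.exp_right

/-- For `X` commuting with `Y`, the derivative of the exponential at `Y` is seen by the trace form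
against `X` as if everything commuted. -/
theorem trace_mul_fderiv_exp {X Y : Mat n} (h : Commute X Y) (H : Mat n) :
    (X * NormedSpace.exp (-Y) * fderiv ℝ NormedSpace.exp Y H).trace = (X * H).trace := by
  have hd : Differentiable ℝ (NormedSpace.exp : Mat n → Mat n) :=
    contDiff_exp.differentiable one_ne_zero
  set g : Mat n → ℝ := fun Z =>
    (X * NormedSpace.exp (-Z) * fderiv ℝ NormedSpace.exp Z H).trace with hg
  have hcont : Continuous g := by
    have h1 : Continuous fun Z : Mat n => fderiv ℝ NormedSpace.exp Z H :=
      (contDiff_exp.continuous_fderiv one_ne_zero).clm_apply continuous_const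
    have h2 : Continuous (NormedSpace.exp : Mat n → Mat n) := contDiff_exp.continuous
    simp only [hg]
    fun_prop
  -- Differentiating exp(2W) = exp(W)² at Z expresses the derivative at 2Z through the one at Z.
  -- Against a matrix commuting with Z, both terms of the product rule have the same trace.
  have hdouble : ∀ Z : Mat n, Commute X Z → g ((2 : ℝ) • Z) = g Z := fun Z hZ => by
    have e1 : HasFDerivAt (fun W : Mat n => NormedSpace.exp ((2 : ℝ) • W))
        ((fderiv ℝ NormedSpace.exp ((2 : ℝ) • Z)).comp
          ((2 : ℝ) • ContinuousLinearMap.id ℝ (Mat n))) Z :=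
      (hd ((2 : ℝ) • Z)).hasFDerivAt.comp Z ((hasFDerivAt_id (𝕜 := ℝ) Z).const_smul (2 : ℝ))
    have e2 := (hd Z).hasFDerivAt.mul' (hd Z).hasFDerivAt
    have e3 : (fun W : Mat n => NormedSpace.exp ((2 : ℝ) • W))
        = fun W => NormedSpace.exp W * NormedSpace.exp W := by
      funext W
      rw [two_smul, Matrix.exp_add_of_commute _ _ (Commute.refl W)]
    rw [e3] at e1
    have e4 := congrArg (fun T : Mat n →L[ℝ] Mat n => T H) (e1.unique e2)
    set D := fderiv ℝ NormedSpace.exp Z H with hD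
    have e5 : (2 : ℝ) • fderiv ℝ NormedSpace.exp ((2 : ℝ) • Z) H
        = NormedSpace.exp Z * D + D * NormedSpace.exp Z := by
      refine Eq.trans ?_ (e4.trans rfl)
      simp
    have e6 : fderiv ℝ NormedSpace.exp ((2 : ℝ) • Z) H
        = (1 / 2 : ℝ) • (NormedSpace.exp Z * D + D * NormedSpace.exp Z) := by
      rw [← e5, smul_smul]
      norm_num
    have e7 : NormedSpace.exp (-((2 : ℝ) • Z))
        = NormedSpace.exp (-Z) * NormedSpace.exp (-Z) := by
      rw [← Matrix.exp_add_of_commute _ _ (Commute.refl _), two_smul, neg_add]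
    have e8 : (X * (NormedSpace.exp (-Z) * NormedSpace.exp (-Z)) *
        (NormedSpace.exp Z * D)).trace = (X * NormedSpace.exp (-Z) * D).trace := by
      congr 1
      calc _ = X * NormedSpace.exp (-Z) * (NormedSpace.exp (-Z) * NormedSpace.exp Z) * D := by
            simp only [Matrix.mul_assoc]
        _ = _ := by rw [exp_neg_mul_exp, Matrix.mul_one]
    have e9 : (X * (NormedSpace.exp (-Z) * NormedSpace.exp (-Z)) *
        (D * NormedSpace.exp Z)).trace = (X * NormedSpace.exp (-Z) * D).trace := by
      rw [← Matrix.mul_assoc, trace_mul_comm]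
      congr 1
      have hc : NormedSpace.exp Z * X = X * NormedSpace.exp Z := (commute_exp hZ).eq.symm
      calc _ = (NormedSpace.exp Z * X) * NormedSpace.exp (-Z) * NormedSpace.exp (-Z) * D := by
            simp only [Matrix.mul_assoc]
        _ = X * (NormedSpace.exp Z * NormedSpace.exp (-Z)) * NormedSpace.exp (-Z) * D := by
            rw [hc]
            simp only [Matrix.mul_assoc]
        _ = _ := by rw [exp_mul_exp_neg, Matrix.mul_one]
    simp only [hg]
    rw [e6, e7, Matrix.mul_smul, trace_smul, Matrix.mul_add, trace_add, e8, e9, smul_eq_mul]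
    ring
  -- Repeated halving moves Y to 0 without changing g, and at 0 the derivative of exp is the
  -- identity.
  have hpow : ∀ k : ℕ, g ((1 / 2 : ℝ) ^ k • Y) = g Y := fun k => by
    induction k with
    | zero => simp
    | succ k ih =>
      rw [← ih, ← hdouble _ (h.smul_right _), smul_smul, pow_succ]
      congr 2
      ring
  have hlim : Tendsto (fun k : ℕ => g ((1 / 2 : ℝ) ^ k • Y)) atTop (𝓝 (g 0)) := by
    refine (hcont.tendsto 0).comp ?_
    have := (tendsto_pow_atTop_nhds_zero_of_lt_one (r := (1 / 2 : ℝ)) (by norm_num)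
      (by norm_num)).smul_const Y
    simpa using this
  simp only [hpow] at hlim
  have h0 : g Y = g 0 := tendsto_nhds_unique tendsto_const_nhds hlim
  have hz : fderiv ℝ (NormedSpace.exp : Mat n → Mat n) 0 = 1 :=
    (hasFDerivAt_exp_zero (𝕂 := ℝ) (𝔸 := Mat n)).fderiv
  change g Y = _
  rw [h0]
  simp only [hg]
  rw [hz, neg_zero, NormedSpace.exp_zero, Matrix.mul_one]
  rfl

/-- The time-one map `N ↦ exp(sym N - ω skew N) exp((1 + ω) skew N)` of the geodesics starting at
the identity. -/
def geodMap (ω : ℝ) (N : Mat n) : Mat n :=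
  NormedSpace.exp (sym N - ω • skew N) * NormedSpace.exp ((1 + ω) • skew N)

/-- The rotation by which the velocity of a geodesic turns during one unit of time. -/
def turn (ω : ℝ) (N : Mat n) : Mat n := NormedSpace.exp ((1 + ω) • skew N)

theorem turn_orthogonal (ω : ℝ) (N : Mat n) : (turn ω N)ᵀ * turn ω N = 1 :=
  transpose_exp_mul_exp (by rw [transpose_smul, transpose_skew, smul_neg])

theorem turn_orthogonal' (ω : ℝ) (N : Mat n) : turn ω N * (turn ω N)ᵀ = 1 :=
  mul_eq_one_comm.1 (turn_orthogonal ω N)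

theorem geodCurve_eq (ω : ℝ) (A M : Mat n) (t : ℝ) :
    geodCurve ω A M t = A * geodMap ω (t • M) := by
  rw [geodCurve, geodMap, sym_smul, skew_smul, smul_sub, smul_comm ω t, mul_comm t, mul_smul,
    Matrix.mul_assoc]

theorem det_geodMap_pos (ω : ℝ) (N : Mat n) : 0 < (geodMap ω N).det := by
  rw [geodMap, det_mul]
  exact mul_pos (det_exp_pos _) (det_exp_pos _)

theorem geodMap_zero (ω : ℝ) : geodMap ω (0 : Mat n) = 1 := by
  simp [geodMap, sym, skew]

theorem geodMap_conj (ω : ℝ) {Q : Mat n} (hQ : Qᵀ * Q = 1) (N : Mat n) :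
    geodMap ω (Qᵀ * N * Q) = Qᵀ * geodMap ω N * Q := by
  have hQ' : Q * Qᵀ = 1 := mul_eq_one_comm.1 hQ
  have hu : IsUnit Q := ⟨⟨Q, Qᵀ, hQ', hQ⟩, rfl⟩
  have hinv : Q⁻¹ = Qᵀ := inv_eq_left_inv hQ
  have hexp : ∀ X : Mat n, NormedSpace.exp (Qᵀ * X * Q) = Qᵀ * NormedSpace.exp X * Q := fun X => by
    rw [← hinv, Matrix.exp_conj' _ _ hu]
  have h1 : sym (Qᵀ * N * Q) - ω • skew (Qᵀ * N * Q) = Qᵀ * (sym N - ω • skew N) * Q := by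
    rw [sym_conj, skew_conj]
    simp [Matrix.mul_sub, Matrix.sub_mul]
  have h2 : (1 + ω) • skew (Qᵀ * N * Q) = Qᵀ * ((1 + ω) • skew N) * Q := by
    rw [skew_conj]
    simp
  rw [geodMap, h1, h2, hexp, hexp, geodMap]
  calc _ = Qᵀ * NormedSpace.exp (sym N - ω • skew N) * (Q * Qᵀ) *
        NormedSpace.exp ((1 + ω) • skew N) * Q := by simp only [Matrix.mul_assoc]
    _ = _ := by
      rw [hQ', Matrix.mul_one]
      simp only [Matrix.mul_assoc]

/-- A geodesic followed by the geodesic with matching velocity is a longer geodesic. -/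
theorem geodMap_mul_turn (ω c : ℝ) (N : Mat n) :
    geodMap ω N * geodMap ω (c • ((turn ω N)ᵀ * N * turn ω N)) = geodMap ω ((1 + c) • N) := by
  have h1 : c • ((turn ω N)ᵀ * N * turn ω N) = (turn ω N)ᵀ * (c • N) * turn ω N := by simp
  have hP : sym ((1 + c) • N) - ω • skew ((1 + c) • N)
      = (sym N - ω • skew N) + c • (sym N - ω • skew N) := by
    rw [sym_smul, skew_smul]
    module
  have hR : (1 + ω) • skew ((1 + c) • N) = c • ((1 + ω) • skew N) + (1 + ω) • skew N := by
    rw [skew_smul]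
    module
  -- Equivariance under conjugation brings the two rotations `turn ω N` and its transpose side by
  -- side, where they cancel.
  rw [h1, geodMap_conj ω (turn_orthogonal ω N)]
  conv_rhs => rw [geodMap, hP, hR, Matrix.exp_add_of_commute _ _ ((Commute.refl _).smul_right c),
    Matrix.exp_add_of_commute _ _ ((Commute.refl _).smul_left c)]
  have hc : geodMap ω (c • N) = NormedSpace.exp (c • (sym N - ω • skew N)) *
      NormedSpace.exp (c • ((1 + ω) • skew N)) := by
    rw [geodMap, sym_smul, skew_smul, smul_sub, smul_comm ω c, smul_comm (1 + ω) c]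
  rw [hc]
  change NormedSpace.exp (sym N - ω • skew N) * turn ω N * _ = _
  calc _ = NormedSpace.exp (sym N - ω • skew N) * (turn ω N * (turn ω N)ᵀ) *
        (NormedSpace.exp (c • (sym N - ω • skew N)) *
          NormedSpace.exp (c • ((1 + ω) • skew N))) * turn ω N := by
        simp only [Matrix.mul_assoc]
    _ = _ := by
      rw [turn_orthogonal', Matrix.mul_one, turn]
      simp only [Matrix.mul_assoc]

theorem contDiff_geodMap (ω : ℝ) : ContDiff ℝ 1 (geodMap ω : Mat n → Mat n) := by
  have ht : ContDiff ℝ 1 (fun N : Mat n => Nᵀ) :=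
    (LinearMap.toContinuousLinearMap (Matrix.transposeLinearEquiv (Fin n) (Fin n) ℝ ℝ).toLinearMap
      : Mat n →L[ℝ] Mat n).contDiff
  have h1 : ContDiff ℝ 1 (fun N : Mat n => sym N - ω • skew N) := by
    simp only [sym, skew]
    fun_prop
  have h2 : ContDiff ℝ 1 (fun N : Mat n => (1 + ω) • skew N) := by
    simp only [skew]
    fun_prop
  exact (contDiff_exp.comp h1).mul (contDiff_exp.comp h2)

/-- The two generators add up to N, so the left-trivialised velocity at time t is N rotated by `turn
ω (t • N)`. Its isotropic norm is therefore constant. -/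
theorem hasDerivAt_geodMap_smul (ω : ℝ) (N : Mat n) (t : ℝ) :
    HasDerivAt (fun s : ℝ => geodMap ω (s • N))
      (geodMap ω (t • N) * ((turn ω (t • N))ᵀ * N * turn ω (t • N))) t := by
  have e : ∀ s : ℝ, geodMap ω (s • N) = NormedSpace.exp (s • (sym N - ω • skew N)) *
      NormedSpace.exp (s • ((1 + ω) • skew N)) := fun s => by
    rw [geodMap, sym_smul, skew_smul, smul_sub, smul_comm ω s, smul_comm (1 + ω) s]
  have hQ : turn ω (t • N) = NormedSpace.exp (t • ((1 + ω) • skew N)) := by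
    rw [turn, skew_smul, smul_comm (1 + ω) t]
  have h1 := hasDerivAt_exp_smul_const (𝕂 := ℝ) (sym N - ω • skew N) t
  have h2 := hasDerivAt_exp_smul_const' (𝕂 := ℝ) ((1 + ω) • skew N) t
  have h3 := h1.mul h2
  have hN : N = (sym N - ω • skew N) + (1 + ω) • skew N := by
    conv_lhs => rw [← sym_add_skew N]
    module
  have horth := turn_orthogonal' ω (t • N)
  rw [hQ] at horth ⊢
  refine (h3.congr_of_eventuallyEq (Eventually.of_forall fun s => e s)).congr_deriv ?_
  rw [e]
  set P := NormedSpace.exp (t • (sym N - ω • skew N))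
  set Q := NormedSpace.exp (t • ((1 + ω) • skew N))
  calc P * (sym N - ω • skew N) * Q + P * ((1 + ω) • skew N * Q)
      = P * ((sym N - ω • skew N) + (1 + ω) • skew N) * Q := by
        simp only [Matrix.mul_add, Matrix.add_mul, Matrix.mul_assoc]
    _ = P * (Q * Qᵀ) * N * Q := by rw [← hN, horth, Matrix.mul_one]
    _ = _ := by simp only [Matrix.mul_assoc]

end GeodMap

/-! ### The Gauss lemma and conservation of momentum -/

section Gauss

variable {n : ℕ}

theorem trace_mul_eq_zero_of_symm_of_skew {X Y : Mat n} (hX : Xᵀ = X) (hY : Yᵀ = -Y) :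
    (X * Y).trace = 0 := by
  have h : (X * Y).trace = -(X * Y).trace := by
    conv_lhs => rw [← trace_transpose, transpose_mul, hX, hY, Matrix.neg_mul, trace_neg,
      trace_mul_comm]
  linarith

/-- Symmetric matrices, in particular multiples of 1, are trace-orthogonal to skew ones, so only the
skew part of the momentum contributes. -/
theorem trace_momentum_mul_of_skew {μ μc κ : ℝ} (N : Mat n) {K : Mat n} (hK : Kᵀ = -K) :
    (momentum μ μc κ N * K).trace = -μc * (skew N * K).trace := by
  have h1 : (sym N * K).trace = 0 := trace_mul_eq_zero_of_symm_of_skew (transpose_sym N) hK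
  have h2 : K.trace = 0 := by
    have := trace_mul_eq_zero_of_symm_of_skew (transpose_one (n := Fin n) (α := ℝ)) hK
    rwa [Matrix.one_mul] at this
  simp only [momentum, Matrix.add_mul, Matrix.sub_mul, Matrix.smul_mul, trace_add, trace_sub,
    trace_smul, Matrix.one_mul, h1, h2, smul_eq_mul]
  ring

theorem transpose_smul_skew (c : ℝ) (N : Mat n) : (c • skew N)ᵀ = -(c • skew N) := by
  rw [transpose_smul, transpose_skew, smul_neg]

theorem fderiv_geodMap (ω : ℝ) (N H : Mat n) :
    fderiv ℝ (geodMap ω) N H =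
      fderiv ℝ NormedSpace.exp (sym N - ω • skew N) (sym H - ω • skew H) * turn ω N +
      NormedSpace.exp (sym N - ω • skew N) *
        fderiv ℝ NormedSpace.exp ((1 + ω) • skew N) ((1 + ω) • skew H) := by
  have hd : Differentiable ℝ (NormedSpace.exp : Mat n → Mat n) :=
    contDiff_exp.differentiable one_ne_zero
  have h1 : HasDerivAt (fun s : ℝ => geodMap ω (N + s • H)) (fderiv ℝ (geodMap ω) N H) 0 :=
    ((contDiff_geodMap ω).differentiable one_ne_zero N).hasFDerivAt.hasLineDerivAt H
  have ha : ∀ s : ℝ, sym (N + s • H) - ω • skew (N + s • H)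
      = (sym N - ω • skew N) + s • (sym H - ω • skew H) := fun s => by
    simp only [sym, skew, transpose_add, transpose_smul]
    module
  have hb : ∀ s : ℝ, (1 + ω) • skew (N + s • H) = (1 + ω) • skew N + s • ((1 + ω) • skew H) :=
    fun s => by
      simp only [skew, transpose_add, transpose_smul]
      module
  have key : ∀ X Y : Mat n, HasDerivAt (fun s : ℝ => NormedSpace.exp (X + s • Y))
      (fderiv ℝ NormedSpace.exp X Y) 0 := fun X Y => (hd X).hasFDerivAt.hasLineDerivAt Y
  have h2 := (key (sym N - ω • skew N) (sym H - ω • skew H)).mul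
    (key ((1 + ω) • skew N) ((1 + ω) • skew H))
  rw [zero_smul, add_zero, zero_smul, add_zero] at h2
  refine h1.unique (h2.congr_of_eventuallyEq (Eventually.of_forall fun s => ?_))
  change geodMap ω (N + s • H) = _
  rw [geodMap, ha, hb]
  rfl

/-- The derivative of the matrix exponential at a skew matrix in a skew direction is tangent to
the orthogonal group. -/
theorem transpose_fderiv_exp_mul {B K : Mat n} (hB : Bᵀ = -B) (hK : Kᵀ = -K) :
    (fderiv ℝ NormedSpace.exp B K * (NormedSpace.exp B)ᵀ)ᵀ =
      -(fderiv ℝ NormedSpace.exp B K * (NormedSpace.exp B)ᵀ) := by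
  have hd : Differentiable ℝ (NormedSpace.exp : Mat n → Mat n) :=
    contDiff_exp.differentiable one_ne_zero
  have h1 : HasDerivAt (fun s : ℝ => NormedSpace.exp (B + s • K))
      (fderiv ℝ NormedSpace.exp B K) 0 := (hd B).hasFDerivAt.hasLineDerivAt K
  set T : Mat n →L[ℝ] Mat n := LinearMap.toContinuousLinearMap
    (Matrix.transposeLinearEquiv (Fin n) (Fin n) ℝ ℝ).toLinearMap
  have h2 : HasDerivAt (fun s : ℝ => (NormedSpace.exp (B + s • K))ᵀ)
      (fderiv ℝ NormedSpace.exp B K)ᵀ 0 := T.hasFDerivAt.comp_hasDerivAt (0 : ℝ) h1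
  have h3 := h1.mul h2
  -- Differentiate the orthogonality relation exp(B + sK) exp(B + sK)ᵀ = 1 at s = 0.
  have h4 : (fun s : ℝ => NormedSpace.exp (B + s • K)) * (fun s : ℝ =>
      (NormedSpace.exp (B + s • K))ᵀ) = fun _ => 1 := by
    funext s
    refine mul_eq_one_comm.1 (transpose_exp_mul_exp ?_)
    rw [transpose_add, transpose_smul, hB, hK, smul_neg, neg_add]
  rw [h4] at h3
  have h5 := h3.unique (hasDerivAt_const (0 : ℝ) (1 : Mat n))
  rw [zero_smul, add_zero] at h5
  rw [transpose_mul, transpose_transpose]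
  exact eq_neg_of_add_eq_zero_right h5

theorem isoInner_turn (hn : 1 ≤ n) {μ μc κ : ℝ} (ω : ℝ) (N V : Mat n) :
    isoInner μ μc κ ((turn ω N)ᵀ * N * turn ω N) V =
      (momentum μ μc κ N * (turn ω N * V * (turn ω N)ᵀ)).trace := by
  rw [isoInner_conj hn (turn_orthogonal ω N), isoInner_eq_trace hn]

/-- This is where the value ω = μc/μ enters: it makes the momentum a multiple of sym N - ω skew N
plus a scalar matrix. -/
theorem commute_momentum {μ μc : ℝ} (hμ : 0 < μ) (κ : ℝ) (N : Mat n) :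
    Commute (momentum μ μc κ N) (sym N - (μc / μ) • skew N) := by
  have h : momentum μ μc κ N
      = μ • (sym N - (μc / μ) • skew N) + ((κ - μ) / n * N.trace) • 1 := by
    rw [momentum, smul_sub, smul_smul, mul_div_cancel₀ _ hμ.ne']
  rw [h]
  exact ((Commute.refl _).smul_left _).add_left ((Commute.one_left _).smul_left _)

/-- The Gauss lemma: `V` is the left-trivialised derivative of the geodesic map in direction
`H`. -/
theorem isoInner_turn_of_fderiv (hn : 1 ≤ n) {μ μc κ : ℝ} (hμ : 0 < μ) {N H V : Mat n}
    (hV : geodMap (μc / μ) N * V = fderiv ℝ (geodMap (μc / μ)) N H) :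
    isoInner μ μc κ ((turn (μc / μ) N)ᵀ * N * turn (μc / μ) N) V = isoInner μ μc κ N H := by
  set ω := μc / μ
  set a := sym N - ω • skew N with ha
  set Q := turn ω N with hQ
  set DP := fderiv ℝ NormedSpace.exp a (sym H - ω • skew H) with hDP
  set DQ := fderiv ℝ NormedSpace.exp ((1 + ω) • skew N) ((1 + ω) • skew H) with hDQ
  have hQQ : Q * Qᵀ = 1 := turn_orthogonal' ω N
  have hgm : geodMap ω N = NormedSpace.exp a * Q := rfl
  rw [fderiv_geodMap, ← ha, ← hDP, ← hDQ, ← hQ, hgm] at hV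
  -- Rotating V back by Q separates the contributions of the two exponential factors. The first
  -- pairs with a momentum commuting with a; the second is skew, so it meets only skew N, which
  -- commutes with its exponent.
  have hQV : Q * V * Qᵀ = NormedSpace.exp (-a) * DP + DQ * Qᵀ := by
    calc Q * V * Qᵀ = (NormedSpace.exp (-a) * NormedSpace.exp a) * Q * V * Qᵀ := by
          rw [exp_neg_mul_exp, Matrix.one_mul]
      _ = NormedSpace.exp (-a) * (NormedSpace.exp a * Q * V) * Qᵀ := by
          simp only [Matrix.mul_assoc]
      _ = NormedSpace.exp (-a) * DP * (Q * Qᵀ) +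
          (NormedSpace.exp (-a) * NormedSpace.exp a) * DQ * Qᵀ := by
          rw [hV]
          simp only [Matrix.mul_add, Matrix.add_mul, Matrix.mul_assoc]
      _ = _ := by rw [hQQ, exp_neg_mul_exp, Matrix.mul_one, Matrix.one_mul]
  have hskew : (DQ * Qᵀ)ᵀ = -(DQ * Qᵀ) :=
    transpose_fderiv_exp_mul (transpose_smul_skew _ N) (transpose_smul_skew _ H)
  have hcomm : Commute (skew N) ((1 + ω) • skew N) := (Commute.refl _).smul_right _
  have hQt : Qᵀ = NormedSpace.exp (-((1 + ω) • skew N)) := by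
    rw [hQ, turn, ← Matrix.exp_transpose, transpose_smul_skew]
  have e1 : (momentum μ μc κ N * (NormedSpace.exp (-a) * DP)).trace
      = (momentum μ μc κ N * (sym H - ω • skew H)).trace := by
    rw [← Matrix.mul_assoc]
    exact trace_mul_fderiv_exp (commute_momentum hμ κ N) _
  have e2 : (momentum μ μc κ N * (DQ * Qᵀ)).trace
      = (momentum μ μc κ N * ((1 + ω) • skew H)).trace := by
    rw [trace_momentum_mul_of_skew N hskew, trace_momentum_mul_of_skew N (transpose_smul_skew _ H),
      ← trace_mul_fderiv_exp hcomm ((1 + ω) • skew H), ← hDQ, ← Matrix.mul_assoc, trace_mul_comm,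
      ← Matrix.mul_assoc, hQt, (commute_exp hcomm.neg_right).eq]
  rw [isoInner_turn hn, ← hQ, hQV, Matrix.mul_add, trace_add, e1, e2, ← trace_add,
    ← Matrix.mul_add, isoInner_eq_trace hn]
  -- The directions recombine: (sym H - ω skew H) + (1 + ω) skew H = H.
  congr 2
  conv_rhs => rw [← sym_add_skew H]
  module

/-- Conservation of momentum along geodesics. -/
theorem isoInner_turn_of_conj (hn : 1 ≤ n) {μ μc κ : ℝ} (hμ : 0 < μ) {N ξ V : Mat n}
    (hV : geodMap (μc / μ) N * V = ξ * geodMap (μc / μ) N) :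
    isoInner μ μc κ ((turn (μc / μ) N)ᵀ * N * turn (μc / μ) N) V = isoInner μ μc κ N ξ := by
  set ω := μc / μ
  set a := sym N - ω • skew N with ha
  set Q := turn ω N with hQ
  have hQQ : Q * Qᵀ = 1 := turn_orthogonal' ω N
  have hgm : geodMap ω N = NormedSpace.exp a * Q := rfl
  rw [hgm] at hV
  have hQV : Q * V * Qᵀ = NormedSpace.exp (-a) * ξ * NormedSpace.exp a := by
    calc Q * V * Qᵀ = (NormedSpace.exp (-a) * NormedSpace.exp a) * Q * V * Qᵀ := by
          rw [exp_neg_mul_exp, Matrix.one_mul]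
      _ = NormedSpace.exp (-a) * (NormedSpace.exp a * Q * V) * Qᵀ := by
          simp only [Matrix.mul_assoc]
      _ = NormedSpace.exp (-a) * ξ * NormedSpace.exp a * (Q * Qᵀ) := by
          rw [hV]
          simp only [Matrix.mul_assoc]
      _ = _ := by rw [hQQ, Matrix.mul_one]
  have hc : NormedSpace.exp a * momentum μ μc κ N = momentum μ μc κ N * NormedSpace.exp a :=
    (commute_exp (commute_momentum hμ κ N)).eq.symm
  rw [isoInner_turn hn, ← hQ, hQV, isoInner_eq_trace hn, ← Matrix.mul_assoc, trace_mul_comm]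
  congr 1
  calc _ = (NormedSpace.exp a * momentum μ μc κ N) * NormedSpace.exp (-a) * ξ := by
        simp only [Matrix.mul_assoc]
    _ = momentum μ μc κ N * (NormedSpace.exp a * NormedSpace.exp (-a)) * ξ := by
        rw [hc]
        simp only [Matrix.mul_assoc]
    _ = _ := by rw [exp_mul_exp_neg, Matrix.mul_one]

/-- The geodesic map is invertible near the origin, with differentiable inverse. -/
theorem exists_geodMap_chart (hn : 1 ≤ n) {μ μc κ : ℝ} (hμ : 0 < μ) (hμc : 0 < μc) (hκ : 0 < κ)
    (ω : ℝ) : ∃ δ : ℝ, 0 < δ ∧ ∃ g : Mat n → Mat n, ∀ N : Mat n, isoNorm μ μc κ N < δ →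
      g (geodMap ω N) = N ∧ DifferentiableAt ℝ g (geodMap ω N) ∧
        ∀ᶠ C in 𝓝 (geodMap ω N), geodMap ω (g C) = C := by
  -- The derivative at 0 is H ↦ (sym H - ω skew H) + (1 + ω) skew H = H, so the inverse function
  -- theorem applies.
  have hfd : fderiv ℝ (geodMap ω) (0 : Mat n) = ContinuousLinearEquiv.refl ℝ (Mat n) := by
    ext1 H
    have hz : fderiv ℝ (NormedSpace.exp : Mat n → Mat n) 0 = 1 :=
      (hasFDerivAt_exp_zero (𝕂 := ℝ) (𝔸 := Mat n)).fderiv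
    have hs : sym (0 : Mat n) = 0 := by simp [sym]
    have hk : skew (0 : Mat n) = 0 := by simp [skew]
    rw [fderiv_geodMap, turn, hs, hk, smul_zero, smul_zero, sub_zero, NormedSpace.exp_zero, hz,
      Matrix.mul_one, Matrix.one_mul]
    change (sym H - ω • skew H) + (1 + ω) • skew H = H
    conv_rhs => rw [← sym_add_skew H]
    module
  have hcd : ContDiffAt ℝ 1 (geodMap ω) (0 : Mat n) := (contDiff_geodMap ω).contDiffAt
  have hderiv : HasFDerivAt (geodMap ω)
      (ContinuousLinearEquiv.refl ℝ (Mat n) : Mat n →L[ℝ] Mat n) 0 := by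
    rw [← hfd]
    exact (hcd.differentiableAt one_ne_zero).hasFDerivAt
  set e := hcd.toOpenPartialHomeomorph (geodMap ω) hderiv one_ne_zero with he
  have he0 : (0 : Mat n) ∈ e.source :=
    hcd.mem_toOpenPartialHomeomorph_source hderiv one_ne_zero
  have hinv : ContDiffAt ℝ 1 e.symm (geodMap ω 0) := hcd.to_localInverse hderiv one_ne_zero
  have hev : ∀ᶠ C in 𝓝 (geodMap ω (0 : Mat n)), DifferentiableAt ℝ e.symm C :=
    (hinv.eventually (by simp)).mono fun C hC => hC.differentiableAt one_ne_zero
  have hcont : Continuous (geodMap ω : Mat n → Mat n) := (contDiff_geodMap ω).continuous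
  have hall : ∀ᶠ N in 𝓝 (0 : Mat n), N ∈ e.source ∧ DifferentiableAt ℝ e.symm (geodMap ω N) :=
    (e.open_source.eventually_mem he0).and (hcont.continuousAt.eventually hev)
  obtain ⟨r, hr, hball⟩ := Metric.eventually_nhds_iff.1 hall
  obtain ⟨c, hc, hle⟩ := exists_norm_le_isoNorm hn hμ hμc hκ
  -- The constant c turns a bound on the isotropic norm into one on the Frobenius norm, in which the
  -- ball of radius r is taken.
  refine ⟨r / c, by positivity, e.symm, fun N hN => ?_⟩
  have hNr : dist N 0 < r := by
    rw [dist_zero_right]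
    calc ‖N‖ ≤ c * isoNorm μ μc κ N := hle N
      _ < c * (r / c) := by gcongr
      _ = r := by field_simp
  obtain ⟨h1, h2⟩ := hball hNr
  exact ⟨e.left_inv h1, h2, (e.open_target.eventually_mem (e.map_source h1)).mono
    fun C hC => e.right_inv hC⟩

end Gauss

/-! ### Broken geodesics of minimal energy -/

section Broken

variable {n : ℕ}

/-- The chart lifts a differentiable curve. Since `geodMap ω ∘ g` is the identity on a whole
neighbourhood, the chain rule identifies the velocity of the lift. -/
theorem hasDerivAt_chart_comp {ω : ℝ} {g : Mat n → Mat n} {N : Mat n}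
    (hg : g (geodMap ω N) = N ∧ DifferentiableAt ℝ g (geodMap ω N) ∧
      ∀ᶠ C in 𝓝 (geodMap ω N), geodMap ω (g C) = C)
    {Γ : ℝ → Mat n} {Γ' : Mat n} {t : ℝ} (hΓ : HasDerivAt Γ Γ' t) (ht : Γ t = geodMap ω N) :
    ∃ N' : Mat n, HasDerivAt (fun s => g (Γ s)) N' t ∧ fderiv ℝ (geodMap ω) N N' = Γ' := by
  obtain ⟨h1, h2, h3⟩ := hg
  rw [← ht] at h2 h3
  have hd : HasDerivAt (fun s => g (Γ s)) (fderiv ℝ g (Γ t) Γ') t :=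
    h2.hasFDerivAt.comp_hasDerivAt t hΓ
  refine ⟨_, hd, ?_⟩
  have hN : g (Γ t) = N := by rw [ht, h1]
  have hE : HasFDerivAt (geodMap ω) (fderiv ℝ (geodMap ω) N) (g (Γ t)) := by
    rw [hN]
    exact ((contDiff_geodMap ω).differentiable one_ne_zero N).hasFDerivAt
  have hc : HasDerivAt (fun s => geodMap ω (g (Γ s)))
      (fderiv ℝ (geodMap ω) N (fderiv ℝ g (Γ t) Γ')) t := (hE.comp_hasDerivAt t hd :)
  exact hc.unique (hΓ.congr_of_eventuallyEq (hΓ.continuousAt.eventually h3))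

/-- A short broken geodesic of minimal energy has no corner. -/
theorem eq_turn_of_minimal (hn : 1 ≤ n) {μ μc κ : ℝ} (hμ : 0 < μ) (hμc : 0 < μc) (hκ : 0 < κ)
    {g : Mat n → Mat n} {x y : Mat n}
    (hx : g (geodMap (μc / μ) x) = x ∧ DifferentiableAt ℝ g (geodMap (μc / μ) x) ∧
      ∀ᶠ C in 𝓝 (geodMap (μc / μ) x), geodMap (μc / μ) (g C) = C)
    (hy : g (geodMap (μc / μ) y) = y ∧ DifferentiableAt ℝ g (geodMap (μc / μ) y) ∧
      ∀ᶠ C in 𝓝 (geodMap (μc / μ) y), geodMap (μc / μ) (g C) = C)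
    (hmin : ∀ x' y' : Mat n,
      geodMap (μc / μ) x' * geodMap (μc / μ) y' = geodMap (μc / μ) x * geodMap (μc / μ) y →
      isoInner μ μc κ x x + isoInner μ μc κ y y ≤ isoInner μ μc κ x' x' + isoInner μ μc κ y' y') :
    y = (turn (μc / μ) x)ᵀ * x * turn (μc / μ) x := by
  set ω := μc / μ with hω
  have hb := isBilinearMap_isoInner hn μ μc κ
  have key : ∀ ξ : Mat n,
      isoInner μ μc κ ((turn ω x)ᵀ * x * turn ω x) ξ = isoInner μ μc κ y ξ := fun ξ => by
    have hexp : HasDerivAt (fun s : ℝ => NormedSpace.exp (s • ξ)) ξ 0 := by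
      have h := hasDerivAt_exp_smul_const (𝕂 := ℝ) ξ 0
      rw [zero_smul, NormedSpace.exp_zero, one_mul] at h
      exact h
    have hexpn : HasDerivAt (fun s : ℝ => NormedSpace.exp (s • -ξ)) (-ξ) 0 := by
      have h := hasDerivAt_exp_smul_const (𝕂 := ℝ) (-ξ) 0
      rw [zero_smul, NormedSpace.exp_zero, one_mul] at h
      exact h
    -- First variation: the corner moves to E(x) exp(sξ), and the second factor becomes exp(-sξ)
    -- E(y), so that the product is unchanged.
    have hΓ : HasDerivAt (fun s : ℝ => geodMap ω x * NormedSpace.exp (s • ξ)) (geodMap ω x * ξ) 0 :=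
      hexp.const_mul _
    have hΔ : HasDerivAt (fun s : ℝ => NormedSpace.exp (s • -ξ) * geodMap ω y)
        (-ξ * geodMap ω y) 0 := hexpn.mul_const _
    have hΓ0 : geodMap ω x * NormedSpace.exp ((0 : ℝ) • ξ) = geodMap ω x := by simp
    have hΔ0 : NormedSpace.exp ((0 : ℝ) • -ξ) * geodMap ω y = geodMap ω y := by simp
    obtain ⟨x', hx1, hx2⟩ := hasDerivAt_chart_comp hx hΓ hΓ0
    obtain ⟨y', hy1, hy2⟩ := hasDerivAt_chart_comp hy hΔ hΔ0
    have d1 := hasDerivAt_isoInner_self hn μ μc κ hx1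
    have d2 := hasDerivAt_isoInner_self hn μ μc κ hy1
    have d3 := d1.add d2
    rw [hΓ0, hΔ0, hx.1, hy.1] at d3
    have hloc : IsLocalMin ((fun s : ℝ => isoInner μ μc κ
          (g (geodMap ω x * NormedSpace.exp (s • ξ))) (g (geodMap ω x * NormedSpace.exp (s • ξ))))
        + fun s : ℝ => isoInner μ μc κ (g (NormedSpace.exp (s • -ξ) * geodMap ω y))
          (g (NormedSpace.exp (s • -ξ) * geodMap ω y))) 0 := by
      have c1 := hΓ.continuousAt.eventually (hΓ0.symm ▸ hx.2.2)
      have c2 := hΔ.continuousAt.eventually (hΔ0.symm ▸ hy.2.2)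
      filter_upwards [c1, c2] with s hs1 hs2
      simp only [Pi.add_apply, hΓ0, hΔ0, hx.1, hy.1]
      refine hmin _ _ ?_
      rw [hs1, hs2]
      calc _ = geodMap ω x * (NormedSpace.exp (s • ξ) * NormedSpace.exp (-(s • ξ))) *
            geodMap ω y := by simp only [Matrix.mul_assoc, smul_neg]
        _ = _ := by rw [exp_mul_exp_neg, Matrix.mul_one]
    have hzero := hloc.hasDerivAt_eq_zero d3
    have g1 : isoInner μ μc κ ((turn ω x)ᵀ * x * turn ω x) ξ = isoInner μ μc κ x x' :=
      isoInner_turn_of_fderiv hn hμ hx2.symm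
    have hdet : IsUnit (geodMap ω y).det := (det_geodMap_pos ω y).ne'.isUnit
    have hV : geodMap ω y * ((geodMap ω y)⁻¹ * (-ξ * geodMap ω y)) = -ξ * geodMap ω y := by
      rw [← Matrix.mul_assoc, mul_nonsing_inv _ hdet, Matrix.one_mul]
    -- For the second piece, the Gauss lemma and conservation of momentum evaluate the same pairing
    -- in two ways, giving ⟨y, y'⟩ = -⟨y, ξ⟩.
    have g2 := isoInner_turn_of_fderiv (κ := κ) hn hμ (hV.trans hy2.symm)
    have g3 := isoInner_turn_of_conj (κ := κ) hn hμ hV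
    have g4 : isoInner μ μc κ y (-ξ) = -isoInner μ μc κ y ξ := by
      rw [← neg_one_smul ℝ ξ, hb.smul_right, smul_eq_mul, neg_one_mul]
    rw [g3, g4] at g2
    linarith
  have hz : isoInner μ μc κ ((turn ω x)ᵀ * x * turn ω x + (-1 : ℝ) • y)
      ((turn ω x)ᵀ * x * turn ω x + (-1 : ℝ) • y) = 0 := by
    rw [hb.add_left, hb.smul_left, key, smul_eq_mul]
    ring
  have := eq_zero_of_isoInner_self hn hμ hμc hκ hz
  rw [neg_one_smul, ← sub_eq_add_neg, sub_eq_zero] at this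
  exact this.symm

/-- The end point of the broken geodesic with the given velocities. -/
def endPoint (ω : ℝ) (l : List (Mat n)) : Mat n := (l.map (geodMap ω)).prod

/-- The energy of the broken geodesic with the given velocities. -/
def energy (μ μc κ : ℝ) (l : List (Mat n)) : ℝ := (l.map fun x => isoInner μ μc κ x x).sum

theorem isoInner_self_le_energy {μ μc κ : ℝ} (hμ : 0 < μ) (hμc : 0 < μc) (hκ : 0 < κ)
    {l : List (Mat n)} {x : Mat n} (hx : x ∈ l) : isoInner μ μc κ x x ≤ energy μ μc κ l := by
  refine List.single_le_sum (fun y hy => ?_) _ (List.mem_map_of_mem hx)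
  obtain ⟨z, -, rfl⟩ := List.mem_map.1 hy
  exact isoInner_self_nonneg hμ hμc hκ z

/-- Fixing the number of pieces makes the problem finite-dimensional: lists become functions on `Fin
k`, and the energy bound cuts out a compact set containing `l₀`. -/
theorem exists_minimal_list (hn : 1 ≤ n) {μ μc κ : ℝ} (hμ : 0 < μ) (hμc : 0 < μc) (hκ : 0 < κ)
    (ω : ℝ) (l₀ : List (Mat n)) : ∃ l : List (Mat n), l.length = l₀.length ∧
      endPoint ω l = endPoint ω l₀ ∧ ∀ l' : List (Mat n), l'.length = l₀.length →
        endPoint ω l' = endPoint ω l₀ → energy μ μc κ l ≤ energy μ μc κ l' := by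
  obtain ⟨k, hk⟩ : ∃ k, l₀.length = k := ⟨_, rfl⟩
  rw [hk]
  have : ProperSpace (Mat n) := FiniteDimensional.proper ℝ (Mat n)
  set cost : (Fin k → Mat n) → ℝ := fun f => energy μ μc κ (List.ofFn f) with hcost
  set S : Set (Fin k → Mat n) := {f | endPoint ω (List.ofFn f) = endPoint ω l₀ ∧
    cost f ≤ energy μ μc κ l₀} with hS
  have hc1 : Continuous cost := by
    have hq := continuous_isoInner_self hn μ μc κ
    have e : cost = fun f => ∑ i, isoInner μ μc κ (f i) (f i) := by
      funext f
      simp only [hcost, energy, List.map_ofFn, List.sum_ofFn]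
      rfl
    rw [e]
    exact continuous_finsetSum _ fun i _ => hq.comp (continuous_apply i)
  have hc2 : Continuous fun f : Fin k → Mat n => endPoint ω (List.ofFn f) := by
    have e : ∀ f : Fin k → Mat n, endPoint ω (List.ofFn f)
        = ((List.finRange k).map fun i => geodMap ω (f i)).prod := fun f => by
      rw [endPoint, List.map_ofFn, List.ofFn_eq_map]
      rfl
    simp only [e]
    exact continuous_list_prod _ fun i _ =>
      (contDiff_geodMap ω).continuous.comp (continuous_apply i)
  have hclosed : IsClosed S :=
    (isClosed_eq hc2 continuous_const).inter (isClosed_le hc1 continuous_const)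
  obtain ⟨c, hc, hle⟩ := exists_norm_le_isoNorm hn hμ hμc hκ
  have hbdd : Bornology.IsBounded S := by
    refine (Metric.isBounded_iff_subset_closedBall 0).2
      ⟨c * Real.sqrt (energy μ μc κ l₀), fun f hf => ?_⟩
    rw [mem_closedBall_zero_iff, pi_norm_le_iff_of_nonneg (by positivity)]
    intro i
    refine (hle _).trans (mul_le_mul_of_nonneg_left (Real.sqrt_le_sqrt ?_) hc.le)
    exact (isoInner_self_le_energy hμ hμc hκ (List.mem_ofFn.2 ⟨i, rfl⟩)).trans hf.2
  have hne : S.Nonempty := by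
    subst hk
    exact ⟨l₀.get, by rw [List.ofFn_get], by simp only [hcost, List.ofFn_get, le_refl]⟩
  obtain ⟨f, hf, hfmin⟩ := (Metric.isCompact_of_isClosed_isBounded hclosed hbdd).exists_isMinOn hne
    hc1.continuousOn
  refine ⟨List.ofFn f, by simp, hf.1, fun l' hl' he => ?_⟩
  by_cases hle' : energy μ μc κ l' ≤ energy μ μc κ l₀
  · obtain ⟨f', rfl⟩ : ∃ f' : Fin k → Mat n, l' = List.ofFn f' := by
      rw [← hl']
      exact ⟨l'.get, (List.ofFn_get l').symm⟩
    exact hfmin ⟨he, hle'⟩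
  · exact hf.2.trans (not_le.1 hle').le

/-- A minimal broken geodesic with short pieces is a geodesic. -/
theorem endPoint_of_minimal (hn : 1 ≤ n) {μ μc κ : ℝ} (hμ : 0 < μ) (hμc : 0 < μc) (hκ : 0 < κ)
    {g : Mat n → Mat n} (l : List (Mat n)) : ∀ (pre : List (Mat n)) (x : Mat n),
    (∀ N ∈ x :: l, g (geodMap (μc / μ) N) = N ∧ DifferentiableAt ℝ g (geodMap (μc / μ) N) ∧
      ∀ᶠ C in 𝓝 (geodMap (μc / μ) N), geodMap (μc / μ) (g C) = C) →
    (∀ l' : List (Mat n), l'.length = (pre ++ x :: l).length →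
      endPoint (μc / μ) l' = endPoint (μc / μ) (pre ++ x :: l) →
        energy μ μc κ (pre ++ x :: l) ≤ energy μ μc κ l') →
    endPoint (μc / μ) (x :: l) = geodMap (μc / μ) (((l.length : ℝ) + 1) • x) ∧
      energy μ μc κ (x :: l) = (l.length + 1) * isoInner μ μc κ x x := by
  set ω := μc / μ with hω
  induction l with
  | nil => intro pre x _ _; simp [endPoint, energy]
  | cons y l ih =>
    intro pre x hchart hmin
    -- Changing only two neighbouring pieces, with their product kept, reduces minimality of the
    -- whole list to minimality of the pair.
    have hy : y = (turn ω x)ᵀ * x * turn ω x := by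
      refine eq_turn_of_minimal hn hμ hμc hκ (hchart x (by simp)) (hchart y (by simp))
        fun x' y' hxy => ?_
      have h := hmin (pre ++ x' :: y' :: l) (by simp) (by
        simp only [endPoint, List.map_append, List.map_cons, List.prod_append, List.prod_cons]
        rw [← Matrix.mul_assoc (geodMap ω x'), hxy, Matrix.mul_assoc])
      simp only [energy, List.map_append, List.map_cons, List.sum_append, List.sum_cons] at h
      linarith
    -- Minimality concerns the full list, so the induction moves `x` into the prefix instead of
    -- dropping it.
    obtain ⟨h1, h2⟩ := ih (pre ++ [x]) y (fun N hN => hchart N (List.mem_cons_of_mem _ hN))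
      (by simpa using hmin)
    constructor
    · have : endPoint ω (x :: y :: l) = geodMap ω x * endPoint ω (y :: l) := by simp [endPoint]
      rw [this, h1, hy, geodMap_mul_turn, List.length_cons]
      congr 2
      push_cast
      ring
    · have : energy μ μc κ (x :: y :: l) = isoInner μ μc κ x x + energy μ μc κ (y :: l) := by
        simp [energy]
      rw [this, h2, hy, isoInner_conj_self hn (turn_orthogonal ω x), List.length_cons]
      push_cast
      ring

/-- A broken geodesic of small energy can be replaced by a single geodesic which is not longer. -/
theorem exists_geodMap_eq_endPoint (hn : 1 ≤ n) {μ μc κ : ℝ} (hμ : 0 < μ) (hμc : 0 < μc)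
    (hκ : 0 < κ) : ∃ δ : ℝ, 0 < δ ∧ ∀ l : List (Mat n), energy μ μc κ l < δ →
      ∃ M : Mat n, geodMap (μc / μ) M = endPoint (μc / μ) l ∧
        isoNorm μ μc κ M ^ 2 ≤ l.length * energy μ μc κ l := by
  obtain ⟨δ, hδ, g, hg⟩ := exists_geodMap_chart hn hμ hμc hκ (μc / μ)
  -- The energy bounds the squared norm of every piece, so below δ² all pieces of the minimiser lie
  -- in the chart.
  refine ⟨δ ^ 2, by positivity, fun l₀ hl₀ => ?_⟩
  obtain ⟨l, hlen, hend, hmin⟩ := exists_minimal_list hn hμ hμc hκ (μc / μ) l₀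
  have hle : energy μ μc κ l ≤ energy μ μc κ l₀ := hmin l₀ rfl rfl
  rw [← hend, ← hlen]
  cases l with
  | nil =>
    refine ⟨0, by simp [endPoint, geodMap_zero], ?_⟩
    simp [isoNorm_zero]
  | cons x l =>
    obtain ⟨h1, h2⟩ := endPoint_of_minimal hn hμ hμc hκ (g := g) l [] x
      (fun N hN => hg N ((Real.sqrt_lt' hδ).2
        ((isoInner_self_le_energy hμ hμc hκ hN).trans_lt (hle.trans_lt hl₀))))
      (fun l' h h' => hmin l' (h.trans hlen) (h'.trans hend))
    refine ⟨_, h1.symm, ?_⟩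
    rw [isoNorm_smul hn _ _ _ (by positivity), mul_pow, isoNorm_sq hμ hμc hκ]
    -- With k equal pieces, ‖kx‖² = k² ‖x‖² is k times the energy k ‖x‖².
    calc _ = ((l.length : ℝ) + 1) * energy μ μc κ (x :: l) := by
          rw [h2]
          ring
      _ ≤ _ := by
          rw [List.length_cons]
          push_cast
          gcongr

/-- A geodesic can be subdivided into pieces of equal length. -/
theorem exists_subdivision (hn : 1 ≤ n) (μ μc κ ω : ℝ) (q : ℕ) : ∀ x : Mat n,
    ∃ l : List (Mat n), endPoint ω l = geodMap ω ((q : ℝ) • x) ∧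
      energy μ μc κ l = q * isoInner μ μc κ x x := by
  induction q with
  | zero => exact fun x => ⟨[], by simp [endPoint, geodMap_zero], by simp [energy]⟩
  | succ q ih =>
    intro x
    obtain ⟨l, h1, h2⟩ := ih ((turn ω x)ᵀ * x * turn ω x)
    refine ⟨x :: l, ?_, ?_⟩
    · have : endPoint ω (x :: l) = geodMap ω x * endPoint ω l := by simp [endPoint]
      rw [this, h1, geodMap_mul_turn]
      congr 2
      push_cast
      ring
    · have : energy μ μc κ (x :: l) = isoInner μ μc κ x x + energy μ μc κ l := by simp [energy]
      rw [this, h2, isoInner_conj_self hn (turn_orthogonal ω x)]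
      push_cast
      ring

/-- The end point of any broken geodesic is reached by a geodesic. -/
theorem exists_geodMap_eq_of_list (hn : 1 ≤ n) {μ μc κ : ℝ} (hμ : 0 < μ) (hμc : 0 < μc)
    (hκ : 0 < κ) (l : List (Mat n)) :
    ∃ M : Mat n, geodMap (μc / μ) M = endPoint (μc / μ) l := by
  obtain ⟨δ, hδ, h⟩ := exists_geodMap_eq_endPoint (n := n) hn hμ hμc hκ
  -- Splitting each piece into q equal ones divides its energy by q, since q ‖x/q‖² = ‖x‖²/q.
  obtain ⟨q, hq⟩ := exists_nat_gt (energy μ μc κ l / δ)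
  have hb := isBilinearMap_isoInner hn μ μc κ
  have hE0 : 0 ≤ energy μ μc κ l := List.sum_nonneg fun y hy => by
    obtain ⟨z, -, rfl⟩ := List.mem_map.1 hy
    exact isoInner_self_nonneg hμ hμc hκ z
  have hq0 : (0 : ℝ) < q := (div_nonneg hE0 hδ.le).trans_lt hq
  have hsub : ∃ l' : List (Mat n), endPoint (μc / μ) l' = endPoint (μc / μ) l ∧
      energy μ μc κ l' = energy μ μc κ l / q := by
    clear hq hE0
    induction l with
    | nil => exact ⟨[], rfl, by simp [energy]⟩
    | cons x l ih =>
      obtain ⟨l', h1, h2⟩ := ih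
      obtain ⟨l'', h3, h4⟩ := exists_subdivision hn μ μc κ (μc / μ) q ((q : ℝ)⁻¹ • x)
      refine ⟨l'' ++ l', ?_, ?_⟩
      · rw [smul_smul, mul_inv_cancel₀ hq0.ne', one_smul] at h3
        simp only [endPoint, List.map_append, List.prod_append, List.map_cons,
          List.prod_cons] at h1 h3 ⊢
        rw [h1, h3]
      · rw [hb.smul_left, hb.smul_right, smul_eq_mul, smul_eq_mul] at h4
        simp only [energy, List.map_append, List.sum_append, List.map_cons,
          List.sum_cons] at h2 h4 ⊢
        rw [h2, h4]
        field_simp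
  obtain ⟨l', h1, h2⟩ := hsub
  obtain ⟨M, hM, -⟩ := h l' (by
    rw [h2, div_lt_iff₀ hq0]
    rwa [div_lt_iff₀ hδ, mul_comm] at hq)
  exact ⟨M, hM.trans h1⟩

end Broken

/-! ### Admissible curves are not shorter than geodesics -/

section Curves

open MeasureTheory

variable {n : ℕ}

/-- The speed of a curve. -/
def speed (μ μc κ : ℝ) (Y : ℝ → Mat n) (t : ℝ) : ℝ :=
  Real.sqrt (metric μ μc κ (Y t) (deriv Y t) (deriv Y t))

theorem speed_nonneg (μ μc κ : ℝ) (Y : ℝ → Mat n) (t : ℝ) : 0 ≤ speed μ μc κ Y t :=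
  Real.sqrt_nonneg _

theorem speed_eq_isoNorm (μ μc κ : ℝ) (Y : ℝ → Mat n) (t : ℝ) :
    speed μ μc κ Y t = isoNorm μ μc κ ((Y t)⁻¹ * deriv Y t) := rfl

theorem continuousOn_inv {Y : ℝ → Mat n} {s : Set ℝ} (hY : ContinuousOn Y s)
    (hdet : ∀ t ∈ s, (Y t).det ≠ 0) : ContinuousOn (fun t => (Y t)⁻¹) s := by
  intro t ht
  obtain ⟨u, hu⟩ := (Matrix.isUnit_iff_isUnit_det (Y t)).2 (hdet t ht).isUnit
  have h := NormedRing.inverse_continuousAt u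
  rw [hu] at h
  simp only [nonsing_inv_eq_ringInverse]
  exact ContinuousAt.comp_continuousWithinAt (f := Y) h (hY t ht)

theorem IsRegularC1.differentiableAt {Y : ℝ → Mat n} {a b : ℝ} (h : IsRegularC1 Y a b) {t : ℝ}
    (ht : t ∈ Ioo a b) : DifferentiableAt ℝ Y t :=
  (h.1.differentiableOn one_ne_zero t (Ioo_subset_Icc_self ht)).differentiableAt
    (Icc_mem_nhds ht.1 ht.2)

/-- At the end points `deriv` need not agree with the one-sided derivative. On the open interval it
does, and the speed computed with `derivWithin` is continuous on the closed one. -/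
theorem IsRegularC1.intervalIntegrable_speed (hn : 1 ≤ n) (μ μc κ : ℝ) {Y : ℝ → Mat n} {a b : ℝ}
    (hab : a < b) (h : IsRegularC1 Y a b) (hdet : ∀ t ∈ Icc a b, (Y t).det ≠ 0) :
    IntervalIntegrable (speed μ μc κ Y) volume a b := by
  have hc : ContinuousOn
      (fun t => isoNorm μ μc κ ((Y t)⁻¹ * derivWithin Y (Icc a b) t)) (Icc a b) :=
    (continuous_isoNorm hn μ μc κ).comp_continuousOn
      ((continuousOn_inv h.1.continuousOn hdet).mul
        (h.1.continuousOn_derivWithin (uniqueDiffOn_Icc hab) le_rfl))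
  refine (hc.intervalIntegrable_of_Icc hab.le).congr_uIoo fun t ht => ?_
  rw [uIoo_of_le hab.le] at ht
  have hderiv : derivWithin Y (Icc a b) t = deriv Y t :=
    derivWithin_of_mem_nhds (Icc_mem_nhds ht.1 ht.2)
  rw [speed_eq_isoNorm, ← hderiv]

theorem IsAdmissible.lt {A B : Mat n} {a b : ℝ} {Y : ℝ → Mat n} (h : IsAdmissible A B a b Y) :
    a < b := by
  obtain ⟨m, p, hp, rfl, rfl, -⟩ := h.piecewise
  exact hp (Fin.last_pos)

theorem IsAdmissible.intervalIntegrable_speed (hn : 1 ≤ n) (μ μc κ : ℝ) {A B : Mat n} {a b : ℝ}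
    {Y : ℝ → Mat n} (h : IsAdmissible A B a b Y) :
    IntervalIntegrable (speed μ μc κ Y) volume a b := by
  obtain ⟨m, p, hp, hpa, hpb, hreg⟩ := h.piecewise
  have hall : ∀ j : Fin (m + 2), IntervalIntegrable (speed μ μc κ Y) volume (p 0) (p j) := by
    intro j
    induction j using Fin.induction with
    | zero => simp
    | succ j ih =>
      refine ih.trans ((hreg j).intervalIntegrable_speed hn μ μc κ (hp j.castSucc_lt_succ)
        fun t ht => h.mem_GL t ⟨?_, ?_⟩)
      · rw [← hpa]
        exact (hp.monotone (Fin.zero_le _)).trans ht.1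
      · rw [← hpb]
        exact ht.2.trans (hp.monotone (Fin.le_last _))
  rw [← hpa, ← hpb]
  exact hall _

/-- Differentiability just to the right of each point, break points included, is what the
continuation argument needs in order to advance. -/
theorem IsAdmissible.exists_differentiableAt {A B : Mat n} {a b : ℝ} {Y : ℝ → Mat n}
    (h : IsAdmissible A B a b Y) {t : ℝ} (ht : t ∈ Ico a b) :
    ∃ t' > t, ∀ τ ∈ Ioo t t', DifferentiableAt ℝ Y τ := by
  obtain ⟨m, p, hp, hpa, hpb, hreg⟩ := h.piecewise
  obtain ⟨j, hj1, hj2⟩ : ∃ j : Fin (m + 1), p j.castSucc ≤ t ∧ t < p j.succ := by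
    by_contra! hcon
    have hall : ∀ j : Fin (m + 2), p j ≤ t := by
      intro j
      induction j using Fin.induction with
      | zero => exact hpa.trans_le ht.1
      | succ j ih => exact hcon j ih
    exact (hpb ▸ hall (Fin.last (m + 1))).not_gt ht.2
  exact ⟨p j.succ, hj2, fun τ hτ => (hreg j).differentiableAt ⟨hj1.trans_lt hτ.1, hτ.2⟩⟩

/-- Along a curve lifted through the geodesic map, the norm of the lift grows at most at the
speed of the curve. -/
theorem isoNorm_lift_le (hn : 1 ≤ n) {μ μc κ : ℝ} (hμ : 0 < μ) (hμc : 0 < μc)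
    (hκ : 0 < κ) {δ : ℝ} {g : Mat n → Mat n}
    (hg : ∀ N : Mat n, isoNorm μ μc κ N < δ →
      g (geodMap (μc / μ) N) = N ∧ DifferentiableAt ℝ g (geodMap (μc / μ) N) ∧
        ∀ᶠ C in 𝓝 (geodMap (μc / μ) N), geodMap (μc / μ) (g C) = C)
    {Y : ℝ → Mat n} {s t : ℝ} (hst : s ≤ t) {A : Mat n}
    (hdet : ∀ τ ∈ Icc s t, (Y τ).det ≠ 0) (hc : ContinuousOn Y (Icc s t))
    (hd : ∀ τ ∈ Ioo s t, DifferentiableAt ℝ Y τ)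
    (hi : IntervalIntegrable (speed μ μc κ Y) volume s t)
    (hlift : ∀ τ ∈ Icc s t, isoNorm μ μc κ (g (A⁻¹ * Y τ)) < δ ∧
      geodMap (μc / μ) (g (A⁻¹ * Y τ)) = A⁻¹ * Y τ) :
    isoNorm μ μc κ (g (A⁻¹ * Y t)) ≤
      isoNorm μ μc κ (g (A⁻¹ * Y s)) + ∫ τ in s..t, speed μ μc κ Y τ := by
  set ω := μc / μ with hω
  set N : ℝ → Mat n := fun τ => g (A⁻¹ * Y τ) with hN
  have hcN : ContinuousOn N (Icc s t) := by
    intro τ hτ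
    have hdg : ContinuousAt g (A⁻¹ * Y τ) := by
      have := (hg _ (hlift τ hτ).1).2.1
      rw [(hlift τ hτ).2] at this
      exact this.continuousAt
    exact ContinuousAt.comp_continuousWithinAt (f := fun τ => A⁻¹ * Y τ) hdg
      (continuousWithinAt_const.mul (hc τ hτ))
  -- By the Gauss lemma ⟨N, N'⟩ is the pairing of the rotated N with the left-trivialised velocity
  -- of Y; Cauchy–Schwarz bounds it.
  have hdN : ∀ τ ∈ Ioo s t, ∃ N' : Mat n, HasDerivAt N N' τ ∧
      isoInner μ μc κ (N τ) N' ≤ isoNorm μ μc κ (N τ) * speed μ μc κ Y τ := by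
    intro τ hτ
    obtain ⟨h1, h2⟩ := hlift τ (Ioo_subset_Icc_self hτ)
    have hΓ : HasDerivAt (fun τ => A⁻¹ * Y τ) (A⁻¹ * deriv Y τ) τ :=
      (hd τ hτ).hasDerivAt.const_mul _
    obtain ⟨N', hN1, hN2⟩ := hasDerivAt_chart_comp (hg _ h1) hΓ h2.symm
    refine ⟨N', hN1, ?_⟩
    have hYdet : IsUnit (Y τ).det := (hdet τ (Ioo_subset_Icc_self hτ)).isUnit
    have hV : geodMap ω (N τ) * ((Y τ)⁻¹ * deriv Y τ) = fderiv ℝ (geodMap ω) (N τ) N' := by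
      change _ = fderiv ℝ (geodMap ω) (g (A⁻¹ * Y τ)) N'
      rw [hN2]
      change geodMap ω (g (A⁻¹ * Y τ)) * _ = _
      rw [h2, Matrix.mul_assoc, ← Matrix.mul_assoc (Y τ), mul_nonsing_inv _ hYdet, Matrix.one_mul]
    rw [← isoInner_turn_of_fderiv (κ := κ) hn hμ hV, speed_eq_isoNorm,
      ← isoNorm_conj hn (turn_orthogonal ω (N τ)) (N τ)]
    exact isoInner_le_isoNorm_mul hn hμ hμc hκ _ _
  choose! N' hN1 hN2 using hdN
  refine le_of_forall_pos_le_add fun ε hε => ?_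
  -- The norm is not differentiable at 0; the term ε² smooths the square root at a cost of at most
  -- ε.
  set ψ : ℝ → ℝ := fun τ => Real.sqrt (ε ^ 2 + isoInner μ μc κ (N τ) (N τ)) with hψ
  have hpos : ∀ τ, 0 < ε ^ 2 + isoInner μ μc κ (N τ) (N τ) := fun τ =>
    add_pos_of_pos_of_nonneg (by positivity) (isoInner_self_nonneg hμ hμc hκ _)
  have hψc : ContinuousOn ψ (Icc s t) :=
    (continuousOn_const.add ((continuous_isoInner_self hn μ μc κ).comp_continuousOn hcN)).sqrt
  have hψd : ∀ τ ∈ Ioo s t, HasDerivWithinAt ψ (2 * isoInner μ μc κ (N τ) (N' τ) / (2 * ψ τ))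
      (Ioi τ) τ := fun τ hτ =>
    (((hasDerivAt_isoInner_self hn μ μc κ (hN1 τ hτ)).const_add (ε ^ 2)).sqrt
      (hpos τ).ne').hasDerivWithinAt
  have hψN : ∀ τ, isoNorm μ μc κ (N τ) ≤ ψ τ := fun τ =>
    Real.sqrt_le_sqrt (le_add_of_nonneg_left (sq_nonneg ε))
  have hmain := intervalIntegral.sub_le_integral_of_hasDeriv_right_of_le hst hψc hψd
    ((intervalIntegrable_iff_integrableOn_Icc_of_le hst).1 hi) fun τ hτ => by
      have hp : 0 < ψ τ := Real.sqrt_pos.2 (hpos τ)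
      rw [mul_div_mul_left _ _ two_ne_zero, div_le_iff₀ hp, mul_comm]
      exact (hN2 τ hτ).trans (mul_le_mul_of_nonneg_right (hψN τ) (speed_nonneg _ _ _ _ _))
  have hs : ψ s ≤ ε + isoNorm μ μc κ (N s) := by
    refine Real.sqrt_le_iff.2 ⟨add_nonneg hε.le (isoNorm_nonneg _ _ _ _), ?_⟩
    rw [add_sq, isoNorm_sq hμ hμc hκ]
    have := mul_nonneg hε.le (isoNorm_nonneg μ μc κ (N s))
    linarith
  have := hψN t
  linarith

/-- A short curve ends at the end point of a geodesic which is not longer. -/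
theorem exists_geodMap_of_short (hn : 1 ≤ n) {μ μc κ : ℝ} (hμ : 0 < μ) (hμc : 0 < μc)
    (hκ : 0 < κ) {δ : ℝ} {g : Mat n → Mat n}
    (hg : ∀ N : Mat n, isoNorm μ μc κ N < δ →
      g (geodMap (μc / μ) N) = N ∧ DifferentiableAt ℝ g (geodMap (μc / μ) N) ∧
        ∀ᶠ C in 𝓝 (geodMap (μc / μ) N), geodMap (μc / μ) (g C) = C)
    {Y : ℝ → Mat n} {a b : ℝ} (hab : a ≤ b)
    (hdet : ∀ t ∈ Icc a b, (Y t).det ≠ 0) (hc : ContinuousOn Y (Icc a b))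
    (hd : ∀ t ∈ Ico a b, ∃ t' > t, ∀ τ ∈ Ioo t t', DifferentiableAt ℝ Y τ)
    (hi : IntervalIntegrable (speed μ μc κ Y) volume a b)
    (hδ : ∫ t in a..b, speed μ μc κ Y t < δ) :
    ∃ N : Mat n, Y a * geodMap (μc / μ) N = Y b ∧
      isoNorm μ μc κ N ≤ ∫ t in a..b, speed μ μc κ Y t := by
  set ω := μc / μ with hω
  set ℓ : ℝ → ℝ := fun t => ∫ τ in a..t, speed μ μc κ Y τ with hℓ
  have hisub : ∀ {s t : ℝ}, s ∈ Icc a b → t ∈ Icc a b →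
      IntervalIntegrable (speed μ μc κ Y) volume s t := fun hs ht =>
    hi.mono_set (by rw [uIcc_of_le hab]; exact uIcc_subset_Icc hs ht)
  have ha : a ∈ Icc a b := left_mem_Icc.2 hab
  have hb : b ∈ Icc a b := right_mem_Icc.2 hab
  have hadd : ∀ {s t : ℝ}, s ∈ Icc a b → t ∈ Icc a b →
      ℓ s + ∫ τ in s..t, speed μ μc κ Y τ = ℓ t := fun hs ht =>
    intervalIntegral.integral_add_adjacent_intervals (hisub ha hs) (hisub hs ht)
  have hℓb : ∀ t ∈ Icc a b, ℓ t ≤ ℓ b := fun t ht => by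
    rw [← hadd ht hb]
    exact le_add_of_nonneg_right
      (intervalIntegral.integral_nonneg ht.2 fun _ _ => speed_nonneg _ _ _ _ _)
  have hℓc : ContinuousOn ℓ (Icc a b) := by
    have := intervalIntegral.continuousOn_primitive_interval' hi (left_mem_uIcc)
    rwa [uIcc_of_le hab] at this
  have hadet : IsUnit (Y a).det := (hdet a ha).isUnit
  obtain ⟨c, hc0, hle⟩ := exists_norm_le_isoNorm hn hμ hμc hκ
  -- Continuous induction along the curve: S is closed in [a, b], contains a, and extends to the
  -- right of each of its points before b.
  set S : Set ℝ := {t | ∃ N : Mat n, Y a * geodMap ω N = Y t ∧ isoNorm μ μc κ N ≤ ℓ t} with hS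
  have hclosed : IsClosed (S ∩ Icc a b) := by
    have : ProperSpace (Mat n) := FiniteDimensional.proper ℝ (Mat n)
    -- S is the projection of a closed subset of K; the radius is the a priori bound on lifts of
    -- isotropic norm at most ℓ b.
    set K : Set (ℝ × Mat n) := Icc a b ×ˢ Metric.closedBall 0 (c * ℓ b) with hK
    have hKc : IsCompact K := isCompact_Icc.prod (isCompact_closedBall _ _)
    have hfst : MapsTo Prod.fst K (Icc a b) := fun p hp => hp.1
    have hF : ContinuousOn (fun p : ℝ × Mat n =>
        (Y a * geodMap ω p.2 - Y p.1, isoNorm μ μc κ p.2 - ℓ p.1)) K := by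
      refine ContinuousOn.prodMk (ContinuousOn.sub ?_ (hc.comp continuousOn_fst hfst))
        (ContinuousOn.sub ?_ (hℓc.comp continuousOn_fst hfst))
      · exact (continuous_const.mul
          ((contDiff_geodMap ω).continuous.comp continuous_snd)).continuousOn
      · exact ((continuous_isoNorm hn μ μc κ).comp continuous_snd).continuousOn
    have hpre := hF.preimage_isClosed_of_isClosed hKc.isClosed
      (isClosed_singleton (x := (0 : Mat n)) |>.prod (isClosed_Iic (a := (0 : ℝ))))
    have himg := ((hKc.of_isClosed_subset hpre inter_subset_left).image continuous_fst).isClosed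
    convert himg using 1
    ext t
    constructor
    · rintro ⟨⟨N, h1, h2⟩, ht⟩
      refine ⟨(t, N), ⟨⟨ht, ?_⟩, ?_, ?_⟩, rfl⟩
      · rw [mem_closedBall_zero_iff]
        exact (hle N).trans (mul_le_mul_of_nonneg_left (h2.trans (hℓb t ht)) hc0.le)
      · exact sub_eq_zero.2 h1
      · exact sub_nonpos.2 h2
    · rintro ⟨⟨t', N⟩, ⟨⟨ht, -⟩, h1, h2⟩, rfl⟩
      exact ⟨⟨N, sub_eq_zero.1 h1, sub_nonpos.1 h2⟩, ht⟩
  have haS : a ∈ S := by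
    refine ⟨0, by rw [geodMap_zero, Matrix.mul_one], ?_⟩
    simp [isoNorm_zero, hℓ]
  refine hclosed.mem_of_ge_of_forall_exists_gt haS hab fun t ht => ?_
  obtain ⟨⟨N, hN1, hN2⟩, ht⟩ := ht
  have htI : t ∈ Icc a b := Ico_subset_Icc_self ht
  have hΓt : (Y a)⁻¹ * Y t = geodMap ω N := by
    rw [← hN1, ← Matrix.mul_assoc, nonsing_inv_mul _ hadet, Matrix.one_mul]
  have hNδ : isoNorm μ μc κ N < δ := hN2.trans_lt ((hℓb t htI).trans_lt hδ)
  obtain ⟨hg1, hg2, hg3⟩ := hg N hNδ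
  rw [← hΓt] at hg2 hg3
  have hΓc : ContinuousWithinAt (fun τ => (Y a)⁻¹ * Y τ) (Icc t b) t :=
    continuousWithinAt_const.mul ((hc t htI).mono (Icc_subset_Icc_left ht.1))
  have hgt : g ((Y a)⁻¹ * Y t) = N := by rw [hΓt, hg1]
  have hNc : ContinuousWithinAt (fun τ => isoNorm μ μc κ (g ((Y a)⁻¹ * Y τ))) (Icc t b) t :=
    (continuous_isoNorm hn μ μc κ).continuousAt.comp_continuousWithinAt
      (ContinuousAt.comp_continuousWithinAt (f := fun τ => (Y a)⁻¹ * Y τ) hg2.continuousAt hΓc)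
  have hev : ∀ᶠ τ in 𝓝[Icc t b] t, isoNorm μ μc κ (g ((Y a)⁻¹ * Y τ)) < δ ∧
      geodMap ω (g ((Y a)⁻¹ * Y τ)) = (Y a)⁻¹ * Y τ := by
    refine (hNc.eventually (gt_mem_nhds ?_)).and (hΓc.eventually hg3)
    simpa only [hgt] using hNδ
  rw [nhdsWithin_Icc_eq_nhdsGE ht.2] at hev
  obtain ⟨t₁, ht₁, hsub⟩ := mem_nhdsGE_iff_exists_Icc_subset.1 hev
  obtain ⟨t₂, ht₂, hdiff⟩ := hd t ht
  set t' := min b (min t₁ t₂) with ht'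
  have htt' : t < t' := lt_min ht.2 (lt_min ht₁ ht₂)
  have ht'b : t' ≤ b := min_le_left _ _
  have ht't₁ : t' ≤ t₁ := (min_le_right _ _).trans (min_le_left _ _)
  have ht't₂ : t' ≤ t₂ := (min_le_right _ _).trans (min_le_right _ _)
  have ht'I : t' ∈ Icc a b := ⟨ht.1.trans htt'.le, ht'b⟩
  have hIsub : Icc t t' ⊆ Icc a b := Icc_subset_Icc ht.1 ht'b
  -- Right of t the lift stays in the chart and the curve is differentiable, so the norm grows by at
  -- most the added length.
  have hgrow := isoNorm_lift_le hn hμ hμc hκ hg htt'.le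
    (fun τ hτ => hdet τ (hIsub hτ)) (hc.mono hIsub)
    (fun τ hτ => hdiff τ ⟨hτ.1, hτ.2.trans_le ht't₂⟩) (hisub htI ht'I)
    (fun τ hτ => hsub ⟨hτ.1, hτ.2.trans ht't₁⟩)
  rw [hgt] at hgrow
  refine ⟨t', ⟨g ((Y a)⁻¹ * Y t'), ?_, ?_⟩, htt', ht'b⟩
  · have h2 : geodMap ω (g ((Y a)⁻¹ * Y t')) = (Y a)⁻¹ * Y t' :=
      (hsub ⟨htt'.le, ht't₁⟩).2
    rw [h2, ← Matrix.mul_assoc, mul_nonsing_inv _ hadet, Matrix.one_mul]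
  · rw [← hadd htI ht'I]
    exact hgrow.trans (add_le_add_left hN2 _)

/-- Every admissible curve can be replaced by a geodesic which is not longer. -/
theorem IsAdmissible.exists_geodMap (hn : 1 ≤ n) {μ μc κ : ℝ} (hμ : 0 < μ) (hμc : 0 < μc)
    (hκ : 0 < κ) {A B : Mat n} {a b : ℝ} {Y : ℝ → Mat n} (h : IsAdmissible A B a b Y) :
    ∃ M : Mat n, A * geodMap (μc / μ) M = B ∧ isoNorm μ μc κ M ≤ curveLength μ μc κ Y a b := by
  obtain ⟨δ₁, hδ₁, g, hg⟩ := exists_geodMap_chart (n := n) hn hμ hμc hκ (μc / μ)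
  obtain ⟨δ₂, hδ₂, hmin⟩ := exists_geodMap_eq_endPoint (n := n) hn hμ hμc hκ
  have hi := h.intervalIntegrable_speed hn μ μc κ
  have hab := h.lt.le
  set ω := μc / μ with hω
  set ℓ : ℝ → ℝ := fun t => ∫ τ in a..t, speed μ μc κ Y τ with hℓ
  have hL : curveLength μ μc κ Y a b = ℓ b := rfl
  have hL0 : 0 ≤ ℓ b := intervalIntegral.integral_nonneg hab fun _ _ => speed_nonneg _ _ _ _ _
  have hisub : ∀ {s t : ℝ}, s ∈ Icc a b → t ∈ Icc a b →
      IntervalIntegrable (speed μ μc κ Y) volume s t := fun hs ht =>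
    hi.mono_set (by rw [uIcc_of_le hab]; exact uIcc_subset_Icc hs ht)
  have ha : a ∈ Icc a b := left_mem_Icc.2 hab
  have hb : b ∈ Icc a b := right_mem_Icc.2 hab
  have hadd : ∀ {s t : ℝ}, s ∈ Icc a b → t ∈ Icc a b →
      ∫ τ in s..t, speed μ μc κ Y τ = ℓ t - ℓ s := fun hs ht =>
    eq_sub_of_add_eq' (intervalIntegral.integral_add_adjacent_intervals (hisub ha hs) (hisub hs ht))
  have hℓc : ContinuousOn ℓ (Icc a b) := by
    have := intervalIntegral.continuousOn_primitive_interval' hi (left_mem_uIcc)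
    rwa [uIcc_of_le hab] at this
  have hshort : ∀ {s t : ℝ}, s ∈ Icc a b → t ∈ Icc s b → ℓ t - ℓ s < δ₁ →
      ∃ N : Mat n, Y s * geodMap ω N = Y t ∧ isoNorm μ μc κ N ≤ ℓ t - ℓ s := by
    intro s t hs ht hlt
    have htI : t ∈ Icc a b := ⟨hs.1.trans ht.1, ht.2⟩
    have hsub : Icc s t ⊆ Icc a b := Icc_subset_Icc hs.1 ht.2
    rw [← hadd hs htI] at hlt ⊢
    exact exists_geodMap_of_short hn hμ hμc hκ hg ht.1 (fun τ hτ => h.mem_GL τ (hsub hτ))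
      (h.continuousOn.mono hsub)
      (fun τ hτ => h.exists_differentiableAt ⟨hs.1.trans hτ.1, hτ.2.trans_le ht.2⟩)
      (hisub hs htI) hlt
  -- The two bounds make every piece of length ℓ b / k fit in the chart, and the total energy k (ℓ b
  -- / k)² small enough for straightening.
  obtain ⟨k, hk⟩ := exists_nat_gt (max (ℓ b / δ₁) (ℓ b ^ 2 / δ₂))
  have hk0 : (0 : ℝ) < k :=
    ((div_nonneg hL0 hδ₁.le).trans (le_max_left _ _)).trans_lt hk
  have hk1 : ℓ b / k < δ₁ := by
    have := (le_max_left _ _).trans_lt hk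
    rw [div_lt_iff₀ hδ₁] at this
    rw [div_lt_iff₀ hk0]
    linarith
  have hk2 : ℓ b ^ 2 / k < δ₂ := by
    have := (le_max_right _ _).trans_lt hk
    rw [div_lt_iff₀ hδ₂] at this
    rw [div_lt_iff₀ hk0]
    linarith
  set r := ℓ b / k with hr
  have hkr : k * r = ℓ b := by rw [hr]; field_simp
  have hr0 : 0 ≤ r := div_nonneg hL0 hk0.le
  have hsplit : ∀ i : ℕ, i ≤ k → ∃ t ∈ Icc a b, ℓ t = i * r ∧ ∃ l : List (Mat n),
      l.length = i ∧ A * endPoint ω l = Y t ∧ energy μ μc κ l ≤ i * r ^ 2 := by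
    intro i
    induction i with
    | zero => exact fun _ => ⟨a, ha, by simp [hℓ], [], rfl,
        by simp [endPoint, h.left_eq], by simp [energy]⟩
    | succ i ih =>
      intro hi'
      obtain ⟨s, hs, hℓs, l, hl1, hl2, hl3⟩ := ih (Nat.le_of_succ_le hi')
      have hmem : ((i + 1 : ℕ) : ℝ) * r ∈ Icc (ℓ s) (ℓ b) := by
        constructor
        · rw [hℓs]
          push_cast
          linarith
        · rw [← hkr]
          gcongr
      obtain ⟨t, ht, hℓt⟩ := intermediate_value_Icc hs.2
        (hℓc.mono (Icc_subset_Icc_left hs.1)) hmem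
      have hdiff : ℓ t - ℓ s = r := by
        rw [hℓt, hℓs]
        push_cast
        ring
      obtain ⟨N, hN1, hN2⟩ := hshort hs ht (hdiff ▸ hk1)
      rw [hdiff] at hN2
      refine ⟨t, ⟨hs.1.trans ht.1, ht.2⟩, hℓt, l ++ [N], by simp [hl1], ?_, ?_⟩
      · simp only [endPoint, List.map_append, List.prod_append, List.map_cons, List.map_nil,
          List.prod_singleton] at hl2 ⊢
        rw [← Matrix.mul_assoc, hl2, hN1]
      · have : isoInner μ μc κ N N ≤ r ^ 2 := by
          rw [← isoNorm_sq hμ hμc hκ]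
          exact pow_le_pow_left₀ (isoNorm_nonneg _ _ _ _) hN2 2
        simp only [energy, List.map_append, List.sum_append, List.map_cons, List.map_nil,
          List.sum_singleton] at hl3 ⊢
        push_cast
        linarith
  obtain ⟨t, ht, hℓt, l, hl1, hl2, hl3⟩ := hsplit k le_rfl
  -- Only ℓ t = ℓ b is known, not t = b; the remaining arc has length 0, so its geodesic has
  -- velocity 0.
  have htb : Y t = B := by
    obtain ⟨N, hN1, hN2⟩ := hshort ht ⟨ht.2, le_rfl⟩ (by rw [hℓt, hkr, sub_self]; exact hδ₁)
    rw [hℓt, hkr, sub_self] at hN2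
    obtain ⟨c, -, hle⟩ := exists_norm_le_isoNorm (n := n) hn hμ hμc hκ
    have hNle := hle N
    rw [le_antisymm hN2 (isoNorm_nonneg _ _ _ _), mul_zero] at hNle
    rw [norm_le_zero_iff.1 hNle, geodMap_zero, Matrix.mul_one, h.right_eq] at hN1
    exact hN1
  have hE : (k : ℝ) * r ^ 2 = ℓ b ^ 2 / k := by
    rw [hr]
    field_simp
  obtain ⟨M, hM1, hM2⟩ := hmin l (hl3.trans_lt (hE ▸ hk2))
  refine ⟨M, by rw [hM1, hl2, htb], ?_⟩
  rw [hL]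
  refine (abs_le_of_sq_le_sq' (hM2.trans ?_) hL0).2
  rw [hl1, ← hkr, mul_pow, sq (k : ℝ), mul_assoc]
  gcongr

end Curves

/-! ### Every matrix of positive determinant is the end point of a geodesic -/

section Surjective

variable {n : ℕ}

/-- The multiplicative monoid generated by the end points of geodesics. -/
def reachable (n : ℕ) (ω : ℝ) : Submonoid (Mat n) := Submonoid.closure (range (geodMap ω))

theorem exists_list_of_mem_reachable {ω : ℝ} {C : Mat n} (hC : C ∈ reachable n ω) :
    ∃ l : List (Mat n), endPoint ω l = C := by
  obtain ⟨l, hl, rfl⟩ := Submonoid.exists_list_of_mem_closure hC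
  clear hC
  induction l with
  | nil => exact ⟨[], rfl⟩
  | cons x l ih =>
    obtain ⟨l', hl'⟩ := ih fun y hy => hl y (List.mem_cons_of_mem _ hy)
    obtain ⟨N, hN⟩ := hl x List.mem_cons_self
    refine ⟨N :: l', ?_⟩
    simp only [endPoint, List.map_cons, List.prod_cons] at hl' ⊢
    rw [hN, hl']

theorem eventually_mem_reachable (hn : 1 ≤ n) (ω : ℝ) :
    ∀ᶠ C in 𝓝 (1 : Mat n), C ∈ reachable n ω := by
  obtain ⟨δ, hδ, g, hg⟩ :=
    -- Any positive parameters serve here, since they only measure the neighbourhood; E depends on ω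
    -- alone.
    exists_geodMap_chart (n := n) hn one_pos one_pos one_pos ω
  have h := (hg 0 (by rwa [isoNorm_zero])).2.2
  rw [geodMap_zero] at h
  exact h.mono fun C hC => Submonoid.subset_closure ⟨g C, hC⟩

/-- Continuous one-parameter groups are reachable. -/
theorem mem_reachable_of_oneParameter (hn : 1 ≤ n) (ω : ℝ) {φ : ℝ → Mat n} (hφ : Continuous φ)
    (h0 : φ 0 = 1) (hadd : ∀ s t, φ (s + t) = φ s * φ t) (t : ℝ) : φ t ∈ reachable n ω := by
  have hlim : Tendsto (fun k : ℕ => φ (t / (k + 1 : ℕ))) atTop (𝓝 1) := by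
    rw [← h0]
    exact (hφ.tendsto 0).comp
      ((tendsto_const_div_atTop_nhds_zero_nat t).comp (tendsto_add_atTop_nat 1))
  -- For large k the element at time t/(k+1) is close to 1, hence reachable, and φ t is its power of
  -- order k+1.
  obtain ⟨k, hk⟩ := (hlim.eventually (eventually_mem_reachable hn ω)).exists
  have hpow : ∀ (m : ℕ) (s : ℝ), φ (m * s) = φ s ^ m := fun m s => by
    induction m with
    | zero => simp [h0]
    | succ m ih =>
      rw [pow_succ, ← ih, ← hadd]
      congr 1
      push_cast
      ring
  have ht : φ t = φ (t / (k + 1 : ℕ)) ^ (k + 1) := by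
    rw [← hpow]
    congr 1
    field_simp
  rw [ht]
  exact pow_mem hk _

theorem transvection_mem_reachable (hn : 1 ≤ n) (ω : ℝ) {i j : Fin n} (hij : i ≠ j) (c : ℝ) :
    transvection i j c ∈ reachable n ω := by
  refine mem_reachable_of_oneParameter hn ω (φ := fun t => transvection i j t) ?_ ?_ ?_ c
  · have e : (fun t : ℝ => transvection i j t) = fun t => 1 + t • single i j (1 : ℝ) := by
      funext t
      simp [transvection]
    rw [e]
    fun_prop
  · simp
  · exact fun s t => (transvection_mul_transvection_same i j hij s t).symm

theorem diagonal_pos_mem_reachable (hn : 1 ≤ n) (ω : ℝ) {v : Fin n → ℝ} (hv : ∀ i, 0 < v i) :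
    diagonal v ∈ reachable n ω := by
  have h := mem_reachable_of_oneParameter hn ω
    (φ := fun t : ℝ => NormedSpace.exp (t • diagonal fun i => Real.log (v i)))
    (contDiff_exp.continuous.comp (continuous_id.smul continuous_const)) (by simp)
    (fun s t => by
      rw [add_smul, Matrix.exp_add_of_commute _ _ (((Commute.refl _).smul_left s).smul_right t)]) 1
  convert h using 1
  rw [one_smul, Matrix.exp_diagonal]
  congr 1
  funext i
  rw [Pi.coe_exp, ← Real.exp_eq_exp_ℝ, Real.exp_log (hv i)]

/-- The half turn in a coordinate plane is a product of transvections. -/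
theorem halfTurn_mem_reachable (hn : 1 ≤ n) (ω : ℝ) {i j : Fin n} (hij : i ≠ j) :
    diagonal (fun k => if k = i ∨ k = j then (-1 : ℝ) else 1) ∈ reachable n ω := by
  -- This product is the quarter turn in the (i, j)-plane; its square is the half turn.
  have hw : transvection i j (1 : ℝ) * transvection j i (-1) * transvection i j 1
      = 1 - single i i 1 - single j j 1 + single i j 1 - single j i 1 := by
    have e : transvection j i (-1 : ℝ) = 1 - single j i 1 := by
      rw [transvection, sub_eq_add_neg, ← neg_one_smul ℝ (single j i (1 : ℝ)), smul_single,
        smul_eq_mul, mul_one]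
    rw [e]
    simp only [transvection, Matrix.mul_add, Matrix.add_mul, Matrix.mul_sub, Matrix.sub_mul,
      Matrix.one_mul, single_mul_single_same, single_mul_single_of_ne, hij.symm,
      ne_eq, not_false_eq_true, mul_one]
    abel
  have hsq : diagonal (fun k => if k = i ∨ k = j then (-1 : ℝ) else 1)
      = (1 - single i i 1 - single j j 1 + single i j 1 - single j i 1) *
        (1 - single i i 1 - single j j 1 + single i j 1 - single j i 1) := by
    have hd : diagonal (fun k => if k = i ∨ k = j then (-1 : ℝ) else 1)
        = 1 - single i i 1 - single i i 1 - single j j 1 - single j j 1 := by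
      ext a b
      simp only [diagonal_apply, Matrix.sub_apply, single_apply, one_apply]
      grind
    rw [hd]
    simp only [Matrix.mul_add, Matrix.add_mul, Matrix.mul_sub, Matrix.sub_mul, Matrix.one_mul,
      single_mul_single_same, single_mul_single_of_ne, hij, hij.symm, ne_eq,
      not_false_eq_true, mul_one]
    abel
  rw [hsq, ← hw]
  have h := mul_mem (mul_mem (transvection_mem_reachable hn ω hij 1)
    (transvection_mem_reachable hn ω hij.symm (-1))) (transvection_mem_reachable hn ω hij 1)
  exact mul_mem h h

/-- A positive product has an even number of negative entries. Half turns remove them two at a time,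
down to positive diagonals, which are exponentials. -/
theorem diagonal_mem_reachable (hn : 1 ≤ n) (ω : ℝ) : ∀ (m : ℕ) {v : Fin n → ℝ},
    (Finset.univ.filter fun i => v i < 0).card = m → 0 < ∏ i, v i →
      diagonal v ∈ reachable n ω := by
  intro m
  induction m using Nat.strong_induction_on with
  | _ m ih =>
    intro v hm hprod
    have hne : ∀ i, v i ≠ 0 := fun i => Finset.prod_ne_zero_iff.1 hprod.ne' i (Finset.mem_univ i)
    by_cases hpos : ∀ i, 0 < v i
    · exact diagonal_pos_mem_reachable hn ω hpos
    push Not at hpos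
    obtain ⟨i, hi⟩ := hpos
    replace hi := lt_of_le_of_ne hi (hne i)
    obtain ⟨j, hji, hj⟩ : ∃ j, j ≠ i ∧ v j < 0 := by
      by_contra! hcon
      have h1 : 0 < ∏ j ∈ Finset.univ.erase i, v j := Finset.prod_pos fun j hj =>
        lt_of_le_of_ne (hcon j (Finset.ne_of_mem_erase hj)) (hne j).symm
      rw [← Finset.mul_prod_erase _ _ (Finset.mem_univ i)] at hprod
      exact (mul_neg_of_neg_of_pos hi h1).not_gt hprod
    set σ : Fin n → ℝ := fun k => if k = i ∨ k = j then (-1 : ℝ) else 1 with hσ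
    have hσσ : ∀ k, σ k * σ k = 1 := fun k => by
      simp only [hσ]
      split_ifs <;> norm_num
    have hσprod : ∏ k, σ k = 1 := by
      have e : σ = fun k => (if k = i then (-1 : ℝ) else 1) * (if k = j then (-1 : ℝ) else 1) := by
        funext k
        simp only [hσ]
        by_cases h1 : k = i
        · have h2 : k ≠ j := fun h => hji (h.symm.trans h1)
          simp [h1, h1 ▸ h2]
        · simp [h1]
      rw [e, Finset.prod_mul_distrib]
      simp
    have hcard : (Finset.univ.filter fun k => σ k * v k < 0).card < m := by
      rw [← hm]
      refine Finset.card_lt_card ((Finset.ssubset_iff_of_subset fun k hk => ?_).2 ⟨i, ?_, ?_⟩)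
      · simp only [Finset.mem_filter, Finset.mem_univ, true_and, hσ] at hk ⊢
        split_ifs at hk with h
        · rcases h with rfl | rfl <;> assumption
        · linarith
      · simpa using hi
      · simp [hσ, hi.le]
    have h1 := ih _ hcard (v := fun k => σ k * v k) rfl (by
      rw [Finset.prod_mul_distrib, hσprod, one_mul]
      exact hprod)
    have h2 := mul_mem (halfTurn_mem_reachable hn ω hji.symm) h1
    rw [diagonal_mul_diagonal] at h2
    have hv : v = fun k => σ k * (σ k * v k) := by
      funext k
      rw [← mul_assoc, hσσ, one_mul]
    rw [hv]
    exact h2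

/-- Gaussian elimination: transvections have determinant 1, so the diagonal factor inherits the
positive determinant. -/
theorem mem_reachable_of_det_pos (hn : 1 ≤ n) (ω : ℝ) {C : Mat n} (hC : 0 < C.det) :
    C ∈ reachable n ω := by
  obtain ⟨L, L', D, rfl⟩ := Pivot.exists_list_transvec_mul_diagonal_mul_list_transvec C
  have hL : ∀ L : List (TransvectionStruct (Fin n) ℝ),
      (L.map TransvectionStruct.toMatrix).prod ∈ reachable n ω := fun L =>
    list_prod_mem fun x hx => by
      obtain ⟨t, -, rfl⟩ := List.mem_map.1 hx
      exact transvection_mem_reachable hn ω t.hij t.c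
  rw [det_mul, det_mul, TransvectionStruct.det_toMatrix_prod, TransvectionStruct.det_toMatrix_prod,
    one_mul, mul_one, det_diagonal] at hC
  exact mul_mem (mul_mem (hL L) (diagonal_mem_reachable hn ω _ rfl hC)) (hL L')

theorem exists_geodMap_eq (hn : 1 ≤ n) {μ μc κ : ℝ} (hμ : 0 < μ) (hμc : 0 < μc) (hκ : 0 < κ)
    {C : Mat n} (hC : 0 < C.det) : ∃ M : Mat n, geodMap (μc / μ) M = C := by
  obtain ⟨l, rfl⟩ := exists_list_of_mem_reachable (mem_reachable_of_det_pos hn (μc / μ) hC)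
  exact exists_geodMap_eq_of_list hn hμ hμc hκ l

end Surjective

/-! ### Geodesics as admissible curves, and the geodesic distance -/

section Distance

open MeasureTheory

variable {n : ℕ}

theorem hasDerivAt_geodCurve (ω : ℝ) (A M : Mat n) (t : ℝ) :
    HasDerivAt (geodCurve ω A M)
      (geodCurve ω A M t * ((turn ω (t • M))ᵀ * M * turn ω (t • M))) t := by
  rw [funext (geodCurve_eq ω A M), Matrix.mul_assoc]
  exact (hasDerivAt_geodMap_smul ω M t).const_mul A

theorem det_geodCurve_pos (ω : ℝ) {A : Mat n} (hA : 0 < A.det) (M : Mat n) (t : ℝ) :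
    0 < (geodCurve ω A M t).det := by
  rw [geodCurve_eq, det_mul]
  exact mul_pos hA (det_geodMap_pos _ _)

theorem contDiff_geodCurve (ω : ℝ) (A M : Mat n) : ContDiff ℝ 1 (geodCurve ω A M) := by
  rw [funext (geodCurve_eq ω A M)]
  exact contDiff_const.mul ((contDiff_geodMap ω).comp (contDiff_id.smul contDiff_const))

theorem speed_geodCurve (hn : 1 ≤ n) (μ μc κ ω : ℝ) {A : Mat n} (hA : 0 < A.det) (M : Mat n)
    (t : ℝ) : speed μ μc κ (geodCurve ω A M) t = isoNorm μ μc κ M := by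
  have hu : IsUnit (geodCurve ω A M t).det := (det_geodCurve_pos ω hA M t).ne'.isUnit
  have hd : deriv (geodCurve ω A M) t = _ := (hasDerivAt_geodCurve ω A M t).deriv
  rw [speed_eq_isoNorm, hd, ← Matrix.mul_assoc,
    nonsing_inv_mul _ hu, Matrix.one_mul, isoNorm_conj hn (turn_orthogonal ω _)]

theorem curveLength_geodCurve (hn : 1 ≤ n) (μ μc κ ω : ℝ) {A : Mat n} (hA : 0 < A.det)
    (M : Mat n) : curveLength μ μc κ (geodCurve ω A M) 0 1 = isoNorm μ μc κ M := by
  change ∫ t in (0 : ℝ)..1, speed μ μc κ (geodCurve ω A M) t = _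
  simp [speed_geodCurve hn μ μc κ ω hA M]

theorem isAdmissible_geodCurve (ω : ℝ) {A M : Mat n} (hA : 0 < A.det) (hM : M ≠ 0) :
    IsAdmissible A (geodCurve ω A M 1) 0 1 (geodCurve ω A M) where
  mem_GL t _ := (det_geodCurve_pos ω hA M t).ne'
  continuousOn := (contDiff_geodCurve ω A M).continuous.continuousOn
  piecewise := by
    refine ⟨0, ![0, 1], ?_, rfl, rfl, ?_⟩
    · refine Fin.strictMono_iff_lt_succ.2 fun i => ?_
      fin_cases i
      simp
    · intro j
      fin_cases j
      refine ⟨(contDiff_geodCurve ω A M).contDiffOn, fun t ht h0 => hM ?_⟩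
      have hI : UniqueDiffWithinAt ℝ (Icc (0 : ℝ) 1) t := uniqueDiffOn_Icc zero_lt_one t ht
      have hd := ((hasDerivAt_geodCurve ω A M t).hasDerivWithinAt (s := Icc 0 1)).derivWithin hI
      have h1 := hd.symm.trans h0
      have hu : IsUnit (geodCurve ω A M t).det := (det_geodCurve_pos ω hA M t).ne'.isUnit
      set T := turn ω (t • M)
      have hT : T * Tᵀ = 1 := turn_orthogonal' ω (t • M)
      -- Undoing the rotation and the left translation recovers M from the velocity, so a vanishing
      -- velocity forces M = 0.
      calc M = T * Tᵀ * M * (T * Tᵀ) := by rw [hT, Matrix.one_mul, Matrix.mul_one]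
        _ = T * ((geodCurve ω A M t)⁻¹ * geodCurve ω A M t) * (Tᵀ * M * T) * Tᵀ := by
            rw [nonsing_inv_mul _ hu, Matrix.mul_one]
            simp only [Matrix.mul_assoc]
        _ = T * (geodCurve ω A M t)⁻¹ * (geodCurve ω A M t * (Tᵀ * M * T)) * Tᵀ := by
            simp only [Matrix.mul_assoc]
        _ = 0 := by rw [h1, Matrix.mul_zero, Matrix.zero_mul]
  left_eq := by rw [geodCurve_eq, zero_smul, geodMap_zero, Matrix.mul_one]
  right_eq := rfl

theorem hasDerivAt_exp_smul (A : Mat n) (c t : ℝ) :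
    HasDerivAt (fun s : ℝ => Real.exp (c * s) • A) ((Real.exp (c * t) * c) • A) t := by
  have h := (((hasDerivAt_id t).const_mul c).exp).smul_const A
  rw [mul_one] at h
  exact h

theorem isRegularC1_of_eqOn_exp {A : Mat n} (hA : A ≠ 0) {c a b : ℝ} (hc : c ≠ 0) (hab : a < b)
    {Y : ℝ → Mat n} (hY : EqOn Y (fun s => Real.exp (c * s) • A) (Icc a b)) :
    IsRegularC1 Y a b := by
  have hcd : ContDiff ℝ 1 (fun s : ℝ => Real.exp (c * s) • A) := by fun_prop
  refine ⟨hcd.contDiffOn.congr hY, fun t ht => ?_⟩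
  have hd := ((hasDerivAt_exp_smul A c t).hasDerivWithinAt (s := Icc a b)).congr hY (hY ht)
  have hne : (Real.exp (c * t) * c) • A ≠ 0 :=
    smul_ne_zero (mul_ne_zero (Real.exp_ne_zero _) hc) hA
  have heq : derivWithin Y (Icc a b) t = _ := hd.derivWithin (uniqueDiffOn_Icc hab t ht)
  exact heq.trans_ne hne

/-- The loop that scales a matrix down by a factor and back up again. -/
theorem geodDist_exp_smul_self_le (hn : 1 ≤ n) (μ μc κ : ℝ) {A : Mat n} (hA : A.det ≠ 0) {ε : ℝ}
    (hε : 0 < ε) : geodDist μ μc κ (Real.exp ε • A) (Real.exp ε • A) ≤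
      ENNReal.ofReal (2 * ε * isoNorm μ μc κ (1 : Mat n)) := by
  have : Nonempty (Fin n) := ⟨⟨0, hn⟩⟩
  have hA0 : A ≠ 0 := by
    rintro rfl
    exact hA det_zero
  set K := isoNorm μ μc κ (1 : Mat n) with hK
  -- The corner at t = 0 is a break point, and regularity holds on each side.
  set Y : ℝ → Mat n := fun t => Real.exp |t| • A with hY
  have hdetY : ∀ t, (Y t).det ≠ 0 := fun t => by
    simp only [hY, det_smul]
    exact mul_ne_zero (pow_ne_zero _ (Real.exp_ne_zero _)) hA
  have hadm : IsAdmissible (Real.exp ε • A) (Real.exp ε • A) (-ε) ε Y :=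
    { mem_GL := fun t _ => hdetY t
      continuousOn := by
        have : Continuous Y := by
          simp only [hY]
          fun_prop
        exact this.continuousOn
      piecewise := by
        refine ⟨1, ![-ε, 0, ε], ?_, rfl, rfl, ?_⟩
        · refine Fin.strictMono_iff_lt_succ.2 fun i => ?_
          fin_cases i <;> simp [hε]
        · intro j
          fin_cases j
          · refine isRegularC1_of_eqOn_exp hA0 (c := -1) (by norm_num) (by simpa using hε)
              fun t ht => ?_
            have ht0 : t ≤ 0 := ht.2
            simp only [hY, abs_of_nonpos ht0, neg_one_mul]
          · refine isRegularC1_of_eqOn_exp hA0 (c := 1) (by norm_num) (by simpa using hε)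
              fun t ht => ?_
            have ht0 : 0 ≤ t := ht.1
            simp only [hY, abs_of_nonneg ht0, one_mul]
      left_eq := by simp only [hY, abs_neg, abs_of_pos hε]
      right_eq := by simp only [hY, abs_of_pos hε] }
  have hspeed : ∀ t : ℝ, t ≠ 0 → speed μ μc κ Y t = K := by
    intro t ht
    have key : ∀ c : ℝ, c ^ 2 = 1 → Y =ᶠ[𝓝 t] (fun s => Real.exp (c * s) • A) →
        speed μ μc κ Y t = K := by
      intro c hc hev
      have hd : deriv Y t = c • Y t := by
        have h : deriv Y t = _ :=
          ((hasDerivAt_exp_smul A c t).congr_of_eventuallyEq hev).deriv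
        rw [h, hev.eq_of_nhds, smul_smul, mul_comm]
      rw [speed_eq_isoNorm, hd, Matrix.mul_smul, nonsing_inv_mul _ (hdetY t).isUnit, isoNorm,
        (isBilinearMap_isoInner hn μ μc κ).smul_left,
        (isBilinearMap_isoInner hn μ μc κ).smul_right, smul_eq_mul, smul_eq_mul, ← mul_assoc,
        ← sq, hc, one_mul, hK, isoNorm]
    rcases lt_or_gt_of_ne ht with h | h
    · refine key (-1) (by norm_num) ?_
      filter_upwards [eventually_lt_nhds h] with s hs
      simp only [hY, abs_of_neg hs, neg_one_mul]
    · refine key 1 (by norm_num) ?_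
      filter_upwards [eventually_gt_nhds h] with s hs
      simp only [hY, abs_of_pos hs, one_mul]
  have hlen : curveLength μ μc κ Y (-ε) ε = 2 * ε * K := by
    have : ∫ t in (-ε)..ε, speed μ μc κ Y t = ∫ _t in (-ε)..ε, K := by
      refine intervalIntegral.integral_congr_ae ?_
      filter_upwards [volume.ae_ne (0 : ℝ)] with t ht _
      exact hspeed t ht
    change ∫ t in (-ε)..ε, speed μ μc κ Y t = _
    rw [this, intervalIntegral.integral_const, smul_eq_mul]
    ring
  rw [← hlen]
  exact iInf_le_of_le (-ε) (iInf_le_of_le ε (iInf_le_of_le Y (iInf_le_of_le hadm le_rfl)))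

/-- There are arbitrarily short admissible loops. -/
theorem geodDist_self (hn : 1 ≤ n) (μ μc κ : ℝ) {A : Mat n} (hA : A.det ≠ 0) :
    geodDist μ μc κ A A = 0 := by
  refine le_antisymm ?_ zero_le
  have hle : ∀ k : ℕ, geodDist μ μc κ A A ≤
      ENNReal.ofReal (2 * (1 / ((k : ℝ) + 1)) * isoNorm μ μc κ (1 : Mat n)) := fun k => by
    set ε : ℝ := 1 / ((k : ℝ) + 1) with hε
    have hε0 : 0 < ε := by positivity
    -- The loop around exp(-ε) A starts and ends at exp(ε) exp(-ε) A = A.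
    have hdet : (Real.exp (-ε) • A).det ≠ 0 := by
      rw [det_smul]
      exact mul_ne_zero (pow_ne_zero _ (Real.exp_ne_zero _)) hA
    have h := geodDist_exp_smul_self_le hn μ μc κ hdet hε0
    rwa [smul_smul, ← Real.exp_add, add_neg_cancel, Real.exp_zero, one_smul] at h
  have hlim : Tendsto (fun k : ℕ => ENNReal.ofReal
      (2 * (1 / ((k : ℝ) + 1)) * isoNorm μ μc κ (1 : Mat n))) atTop (𝓝 0) := by
    rw [← ENNReal.ofReal_zero]
    refine ENNReal.tendsto_ofReal ?_
    have := ((tendsto_one_div_add_atTop_nhds_zero_nat (𝕜 := ℝ)).const_mul 2).mul_const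
      (isoNorm μ μc κ (1 : Mat n))
    rwa [mul_zero, zero_mul] at this
  exact ge_of_tendsto' hlim hle

/-- Among the geodesics with given end points there is a shortest one. -/
theorem exists_isoNorm_minimal (hn : 1 ≤ n) {μ μc κ : ℝ} (hμ : 0 < μ) (hμc : 0 < μc)
    (hκ : 0 < κ) {A B : Mat n} (hA : 0 < A.det) (hB : 0 < B.det) :
    ∃ M : Mat n, A * geodMap (μc / μ) M = B ∧
      ∀ M' : Mat n, A * geodMap (μc / μ) M' = B → isoNorm μ μc κ M ≤ isoNorm μ μc κ M' := by
  have hu : IsUnit A.det := hA.ne'.isUnit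
  have hC : 0 < (A⁻¹ * B).det := by
    rw [det_mul, det_nonsing_inv, Ring.inverse_eq_inv']
    positivity
  obtain ⟨M₁, hM₁⟩ := exists_geodMap_eq hn hμ hμc hκ hC
  replace hM₁ : A * geodMap (μc / μ) M₁ = B := by
    rw [hM₁, ← Matrix.mul_assoc, mul_nonsing_inv _ hu, Matrix.one_mul]
  have : ProperSpace (Mat n) := FiniteDimensional.proper ℝ (Mat n)
  obtain ⟨c, hc, hle⟩ := exists_norm_le_isoNorm (n := n) hn hμ hμc hκ
  -- Restricting to velocities no longer than M₁ makes the set compact; longer ones cannot compete.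
  set S : Set (Mat n) := {M | A * geodMap (μc / μ) M = B} ∩
    {M | isoNorm μ μc κ M ≤ isoNorm μ μc κ M₁}
  have hclosed : IsClosed S :=
    (isClosed_eq (continuous_const.mul (contDiff_geodMap _).continuous) continuous_const).inter
      (isClosed_le (continuous_isoNorm hn μ μc κ) continuous_const)
  have hbdd : Bornology.IsBounded S :=
    (Metric.isBounded_iff_subset_closedBall 0).2 ⟨c * isoNorm μ μc κ M₁, fun M hM => by
      rw [mem_closedBall_zero_iff]
      exact (hle M).trans (mul_le_mul_of_nonneg_left hM.2 hc.le)⟩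
  obtain ⟨M, hM, hmin⟩ := (Metric.isCompact_of_isClosed_isBounded hclosed hbdd).exists_isMinOn
    ⟨M₁, hM₁, le_refl (isoNorm μ μc κ M₁)⟩ (continuous_isoNorm hn μ μc κ).continuousOn
  refine ⟨M, hM.1, fun M' hM' => ?_⟩
  by_cases h : isoNorm μ μc κ M' ≤ isoNorm μ μc κ M₁
  · exact hmin ⟨hM', h⟩
  · exact hM.2.trans (not_le.1 h).le

/-- A shortest geodesic realises the geodesic distance. -/
theorem geodDist_eq_of_minimal (hn : 1 ≤ n) {μ μc κ : ℝ} (hμ : 0 < μ) (hμc : 0 < μc)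
    (hκ : 0 < κ) {A B M : Mat n} (hA : 0 < A.det) (hM0 : M ≠ 0)
    (hM : A * geodMap (μc / μ) M = B)
    (hmin : ∀ M' : Mat n, A * geodMap (μc / μ) M' = B → isoNorm μ μc κ M ≤ isoNorm μ μc κ M') :
    geodDist μ μc κ A B = ENNReal.ofReal (isoNorm μ μc κ M) := by
  have h1 : geodCurve (μc / μ) A M 1 = B := by rw [geodCurve_eq, one_smul, hM]
  have hadm := isAdmissible_geodCurve (μc / μ) hA hM0
  rw [h1] at hadm
  refine le_antisymm ?_ ?_
  · rw [← curveLength_geodCurve hn μ μc κ (μc / μ) hA M]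
    exact iInf_le_of_le 0 (iInf_le_of_le 1 (iInf_le_of_le _ (iInf_le_of_le hadm le_rfl)))
  · refine le_iInf fun a => le_iInf fun b => le_iInf fun Y => le_iInf fun hY => ?_
    obtain ⟨M', hM', hle⟩ := hY.exists_geodMap hn hμ hμc hκ
    exact ENNReal.ofReal_le_ofReal ((hmin M' hM').trans hle)

end Distance

end Geodesics

end GLGeodesic

end

theorem mainTheorem1 (n : ℕ) (hn : 1 ≤ n) (μ μc κ : ℝ) (hμ : 0 < μ) (hμc : 0 < μc) (hκ : 0 < κ)
    (A B : GLGeodesic.Mat n) (hA : A ∈ GLGeodesic.GLPosSet n) (hB : B ∈ GLGeodesic.GLPosSet n) :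
    ∃ M : GLGeodesic.Mat n,
      (∀ t ∈ Set.Icc (0 : ℝ) 1, GLGeodesic.geodCurve (μc / μ) A M t ∈ GLGeodesic.GLPosSet n) ∧
      GLGeodesic.geodCurve (μc / μ) A M 0 = A ∧
      GLGeodesic.geodCurve (μc / μ) A M 1 = B ∧
      (A ≠ B → GLGeodesic.IsAdmissible A B 0 1 (GLGeodesic.geodCurve (μc / μ) A M)) ∧
      GLGeodesic.isoNorm μ μc κ M =
        GLGeodesic.curveLength μ μc κ (GLGeodesic.geodCurve (μc / μ) A M) 0 1 ∧
      ENNReal.ofReal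
          (GLGeodesic.curveLength μ μc κ (GLGeodesic.geodCurve (μc / μ) A M) 0 1) =
        GLGeodesic.geodDist μ μc κ A B := by
  have hA' : 0 < A.det := hA
  have hcurve : ∀ M : GLGeodesic.Mat n,
      (∀ t ∈ Set.Icc (0 : ℝ) 1, GLGeodesic.geodCurve (μc / μ) A M t ∈ GLGeodesic.GLPosSet n) ∧
        GLGeodesic.geodCurve (μc / μ) A M 0 = A := fun M =>
    ⟨fun t _ => GLGeodesic.det_geodCurve_pos (μc / μ) hA' M t, by
      rw [GLGeodesic.geodCurve_eq, zero_smul, GLGeodesic.geodMap_zero, Matrix.mul_one]⟩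
  -- For A = B take M = 0, whose length 0 matches the infimum over short loops. For A ≠ B the
  -- minimiser is nonzero, so its curve is regular and admissible.
  by_cases hAB : A = B
  · subst hAB
    refine ⟨0, (hcurve 0).1, (hcurve 0).2, ?_, fun h => absurd rfl h,
      (GLGeodesic.curveLength_geodCurve hn μ μc κ _ hA' 0).symm, ?_⟩
    · rw [GLGeodesic.geodCurve_eq, smul_zero, GLGeodesic.geodMap_zero, Matrix.mul_one]
    · rw [GLGeodesic.geodDist_self hn μ μc κ hA'.ne',
        GLGeodesic.curveLength_geodCurve hn μ μc κ _ hA' 0, GLGeodesic.isoNorm_zero,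
        ENNReal.ofReal_zero]
  · obtain ⟨M, hM, hmin⟩ := GLGeodesic.exists_isoNorm_minimal hn hμ hμc hκ hA' hB
    have hM0 : M ≠ 0 := by
      rintro rfl
      rw [GLGeodesic.geodMap_zero, Matrix.mul_one] at hM
      exact hAB hM
    have h1 : GLGeodesic.geodCurve (μc / μ) A M 1 = B := by
      rw [GLGeodesic.geodCurve_eq, one_smul, hM]
    refine ⟨M, (hcurve M).1, (hcurve M).2, h1, fun _ => ?_,
      (GLGeodesic.curveLength_geodCurve hn μ μc κ _ hA' M).symm, ?_⟩
    · have hadm := GLGeodesic.isAdmissible_geodCurve (μc / μ) hA' hM0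
      rwa [h1] at hadm
    · rw [GLGeodesic.curveLength_geodCurve hn μ μc κ _ hA' M,
        GLGeodesic.geodDist_eq_of_minimal hn hμ hμc hκ hA' hM0 hM hmin]
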